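/- Let $G$ be a compact Lie group whose Killing form $B$ is negative definite (i.e. $G$ is semisimple), put $\langle\cdot,\cdot\rangle=-B$ on the Lie algebra $\mathfrak g$, let $H\subset G$ be a closed subgroup with Lie algebra $\mathfrak h$, and give $G/H$ its usual structure of a smooth manifold, of dimension $n$. Suppose that $G/H$ is a generalized Wallach space: the $\langle\cdot,\cdot\rangle$-orthogonal complement $\mathfrak p$ of $\mathfrak h$ is a direct sum $\mathfrak p=\mathfrak p_1\oplus\mathfrak p_2\oplus\mathfrak p_3$ of three pairwise orthogonal, irreducible $\mathrm{Ad}(H)$-modules with $[\mathfrak p_i,\mathfrak p_i]\subset\mathfrak h$ for $i=1,2,3$. Let $a_i=A/\dim\mathfrak p_i$, where $A=\sum_{\alpha,\beta,\gamma}\langle[e_1^\alpha,e_2^\beta],e_3^\gamma\rangle^2$ for $\langle\cdot,\cdot\rangle$-orthonormal bases $(e_i^\alpha)_\alpha$ of $\mathfrak p_i$, and suppose that $a_1=a_2=a_3=\tfrac16$. For $x_1,x_2,x_3>0$ consider the $G$-invariant Riemannian metric on $G/H$ determined by the inner product $$(\cdot,\cdot)=x_1\langle\cdot,\cdot\rangle|_{\mathfrak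 p_1}+x_2\langle\cdot,\cdot\rangle|_{\mathfrak p_2}+x_3\langle\cdot,\cdot\rangle|_{\mathfrak p_3}\qquad(*)$$ on $\mathfrak p\cong T_{eH}(G/H)$. Let $\mathbf g(t)$, $t\in[0,T)$, be a solution, consisting of metrics of the form $(*)$ with parameters $x_i(t)$, of the normalized Ricci flow $$\frac{\partial}{\partial t}\mathbf g(t)=-2\,\mathrm{Ric}_{\mathbf g(t)}+2\,\mathbf g(t)\frac{S_{\mathbf g(t)}}{n},$$ where $\mathrm{Ric}$ and $S$ are the Ricci tensor and the scalar curvature. If $x_k(0)<x_i(0)+x_j(0)$ for all indices with $\{i,j,k\}=\{1,2,3\}$, then $\mathbf g(t)$ has positive Ricci curvature for every $t\in[0,T)$. -/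

import Mathlib

open Set Bundle
open scoped Manifold ContDiff

noncomputable section

namespace Wallach

/-! ### Riemannian geometry: Levi-Civita connection, curvature, Ricci flow -/

section Riemannian

variable {n : ℕ} {M : Type*} [TopologicalSpace M] [ChartedSpace (EuclideanSpace ℝ (Fin n)) M]
  [IsManifold (𝓡 n) ∞ M]

variable (n M) in
/-- Smooth Riemannian metrics on the `n`-dimensional manifold `M`. -/
abbrev Metric : Type _ :=
  ContMDiffRiemannianMetric (𝓡 n) ∞ (EuclideanSpace ℝ (Fin n)) (TangentSpace (𝓡 n) : M → Type _)

variable (n M) in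
/-- Covariant derivatives on the tangent bundle. On paper `cov Y x (X x)` is `(∇_X Y)(x)`. -/
abbrev Connection : Type _ :=
  CovariantDerivative (𝓡 n) (EuclideanSpace ℝ (Fin n)) (TangentSpace (𝓡 n) : M → Type _)

/-- `X` is a smooth vector field on `M`. -/
def IsSmoothField (X : ∀ y : M, TangentSpace (𝓡 n) y) : Prop :=
  ContMDiff (𝓡 n) ((𝓡 n).prod 𝓘(ℝ, EuclideanSpace ℝ (Fin n))) ∞
    (fun y => (⟨y, X y⟩ : TangentBundle (𝓡 n) M))

/-- `cov` is the Levi-Civita connection of `g`: smooth, torsion free and metric. -/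
structure IsLeviCivita (g : Metric n M) (cov : Connection n M) : Prop where
  smooth : CovariantDerivative.ContMDiffCovariantDerivative cov ∞
  torsion_eq_zero : cov.torsion = 0
  metric : ∀ Y Z : (∀ y : M, TangentSpace (𝓡 n) y), IsSmoothField Y → IsSmoothField Z →
    ∀ (y : M) (v : TangentSpace (𝓡 n) y),
      (mfderiv (𝓡 n) 𝓘(ℝ, ℝ) (fun q => g.inner q (Y q) (Z q)) y v : ℝ) =
        g.inner y (cov Y y v) (Z y) + g.inner y (Y y) (cov Z y v)

/-- `R` is the curvature tensor of `cov`: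
`R(X,Y)Z = ∇_X ∇_Y Z - ∇_Y ∇_X Z - ∇_[X,Y] Z` for all smooth vector fields. -/
def IsCurvatureTensor (cov : Connection n M)
    (R : ∀ y : M, TangentSpace (𝓡 n) y →ₗ[ℝ] TangentSpace (𝓡 n) y →ₗ[ℝ]
      TangentSpace (𝓡 n) y →ₗ[ℝ] TangentSpace (𝓡 n) y) : Prop :=
  ∀ X Y Z : (∀ y : M, TangentSpace (𝓡 n) y),
    IsSmoothField X → IsSmoothField Y → IsSmoothField Z → ∀ y : M,
      R y (X y) (Y y) (Z y) =
        cov (fun q => cov Z q (Y q)) y (X y) - cov (fun q => cov Z q (X q)) y (Y y)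
          - cov Z y (VectorField.mlieBracket (𝓡 n) X Y y)

/-- `Ric` is the Ricci tensor of `g`: `Ric(v,w)` is the trace of `u ↦ R(u,v)w`, where `R` is the
curvature tensor of the Levi-Civita connection of `g`. -/
def IsRicciTensor (g : Metric n M)
    (Ric : ∀ y : M, TangentSpace (𝓡 n) y → TangentSpace (𝓡 n) y → ℝ) : Prop :=
  ∃ cov : Connection n M, IsLeviCivita g cov ∧
    ∃ R : (∀ y : M, TangentSpace (𝓡 n) y →ₗ[ℝ] TangentSpace (𝓡 n) y →ₗ[ℝ]
        TangentSpace (𝓡 n) y →ₗ[ℝ] TangentSpace (𝓡 n) y),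
      IsCurvatureTensor cov R ∧
        ∀ (y : M) (v w : TangentSpace (𝓡 n) y),
          Ric y v w = LinearMap.trace ℝ (TangentSpace (𝓡 n) y) (((R y).flip v).flip w)

/-- `S` is the trace of `Ric` with respect to `g` (the scalar curvature, when `Ric` is the Ricci
tensor of `g`): `S = ∑ Ric(e_i, e_i)` for every `g`-orthonormal basis. -/
def IsScalarCurvature (g : Metric n M)
    (Ric : ∀ y : M, TangentSpace (𝓡 n) y → TangentSpace (𝓡 n) y → ℝ) (S : M → ℝ) : Prop :=
  ∀ (y : M) (e : Module.Basis (Fin n) ℝ (TangentSpace (𝓡 n) y)),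
    (∀ i j, g.inner y (e i) (e j) = if i = j then 1 else 0) → S y = ∑ i, Ric y (e i) (e i)

/-- The Ricci curvature of `g` is positive. -/
def HasPositiveRicci (g : Metric n M) : Prop :=
  ∃ Ric : (∀ y : M, TangentSpace (𝓡 n) y → TangentSpace (𝓡 n) y → ℝ),
    IsRicciTensor g Ric ∧ ∀ (y : M) (v : TangentSpace (𝓡 n) y), v ≠ 0 → 0 < Ric y v v

/-- `g t`, `t ∈ [0, T)`, solves the normalized Ricci flow `∂g/∂t = -2 Ric_g + 2 g S_g / n`. -/
def IsNormalizedRicciFlow (T : ℝ) (g : ℝ → Metric n M) : Prop :=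
  ∀ t ∈ Ico (0 : ℝ) T,
    ∃ (Ric : ∀ y : M, TangentSpace (𝓡 n) y → TangentSpace (𝓡 n) y → ℝ) (S : M → ℝ),
      IsRicciTensor (g t) Ric ∧ IsScalarCurvature (g t) Ric S ∧
        ∀ (y : M) (v w : TangentSpace (𝓡 n) y),
          HasDerivWithinAt (fun s => (g s).inner y v w)
            (-2 * Ric y v w + 2 * (g t).inner y v w * (S y / n)) (Ico 0 T) t

end Riemannian

/-! ### Homogeneous spaces and generalized Wallach spaces -/

section Homogeneous

variable {m : ℕ} {G : Type*} [TopologicalSpace G] [ChartedSpace (EuclideanSpace ℝ (Fin m)) G]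
  [Group G]

/-- Lets the Lie algebra structure on the tangent space at `1` be found for smooth Lie groups. -/
instance lieGroupMinSmoothness [LieGroup (𝓡 m) ∞ G] : LieGroup (𝓡 m) (minSmoothness ℝ 3) G :=
  LieGroup.of_le (n := ∞) (by rw [minSmoothness_of_isRCLikeNormedField]; exact ENat.LEInfty.out)

/-- The adjoint action of `h` on the Lie algebra: the differential at `1` of `q ↦ h q h⁻¹`
(which fixes `1`). -/
def Ad (h : G) : GroupLieAlgebra (𝓡 m) G → GroupLieAlgebra (𝓡 m) G :=
  fun X => (mfderiv (𝓡 m) (𝓡 m) (fun q : G => h * q * h⁻¹) 1 : _ → _) X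

/-- The inner product `-B` on the Lie algebra, where `B` is the Killing form. -/
def negKilling [LieGroup (𝓡 m) ∞ G] (X Y : GroupLieAlgebra (𝓡 m) G) : ℝ :=
  -killingForm ℝ (GroupLieAlgebra (𝓡 m) G) X Y

variable {n : ℕ} (H : Subgroup G) [ChartedSpace (EuclideanSpace ℝ (Fin n)) (G ⧸ H)]

/-- The manifold structure on `G ⧸ H` is that of the homogeneous space: the projection `G → G ⧸ H`
is a smooth submersion and `G` acts smoothly. -/
structure IsHomogeneousManifold (m n : ℕ) {G : Type*} [TopologicalSpace G]
    [ChartedSpace (EuclideanSpace ℝ (Fin m)) G] [Group G] (H : Subgroup G)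
    [ChartedSpace (EuclideanSpace ℝ (Fin n)) (G ⧸ H)] : Prop where
  smooth_mk : ContMDiff (𝓡 m) (𝓡 n) ∞ (fun a : G => (a : G ⧸ H))
  submersion : ∀ a : G,
    Function.Surjective (mfderiv (𝓡 m) (𝓡 n) (fun b : G => (b : G ⧸ H)) a)
  smooth_smul : ContMDiffSMul (𝓡 m) (𝓡 n) ∞ G (G ⧸ H)

/-- The differential at `1` of the projection `G → G ⧸ H`. -/
def dproj (n : ℕ) (H : Subgroup G) [ChartedSpace (EuclideanSpace ℝ (Fin n)) (G ⧸ H)] :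
    GroupLieAlgebra (𝓡 m) G →L[ℝ] TangentSpace (𝓡 n) ((1 : G) : G ⧸ H) :=
  mfderiv (𝓡 m) (𝓡 n) (fun a : G => (a : G ⧸ H)) 1

/-- The Lie algebra of `H`, as a subspace of the Lie algebra of `G`: the vectors tangent at `1` to
the fibre `H` of the submersion `G → G ⧸ H`. -/
def isotropyAlgebra (n : ℕ) (H : Subgroup G) [ChartedSpace (EuclideanSpace ℝ (Fin n)) (G ⧸ H)] :
    Submodule ℝ (GroupLieAlgebra (𝓡 m) G) :=
  LinearMap.ker (dproj (m := m) n H).toLinearMap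

/-- `W` is invariant under `Ad(H)`. -/
def IsAdInvariant (H : Subgroup G) (W : Submodule ℝ (GroupLieAlgebra (𝓡 m) G)) : Prop :=
  ∀ h ∈ H, ∀ X ∈ W, Ad h X ∈ W

/-- `G ⧸ H` is a generalized Wallach space with modules `p 0, p 1, p 2`: the Killing form of `G` is
negative definite (`G` is semisimple), `H` is closed, and the orthogonal complement of the Lie
algebra of `H` with respect to `-B` is the orthogonal sum of the three irreducible
`Ad(H)`-modules `p i`, which satisfy `[p i, p i] ⊆ 𝔥`. -/
structure IsGeneralizedWallach (n : ℕ) [LieGroup (𝓡 m) ∞ G] (H : Subgroup G)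
    [ChartedSpace (EuclideanSpace ℝ (Fin n)) (G ⧸ H)]
    (p : Fin 3 → Submodule ℝ (GroupLieAlgebra (𝓡 m) G)) : Prop where
  isClosed : IsClosed (H : Set G)
  homogeneous : IsHomogeneousManifold m n H
  pos : ∀ X : GroupLieAlgebra (𝓡 m) G, X ≠ 0 → 0 < negKilling X X
  sum_eq : ∀ X : GroupLieAlgebra (𝓡 m) G,
    X ∈ ⨆ i, p i ↔ ∀ Y ∈ isotropyAlgebra n H, negKilling X Y = 0
  orthogonal : ∀ i j, i ≠ j → ∀ X ∈ p i, ∀ Y ∈ p j, negKilling X Y = 0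
  invariant : ∀ i, IsAdInvariant H (p i)
  ne_bot : ∀ i, p i ≠ ⊥
  irreducible : ∀ i, ∀ W ≤ p i, IsAdInvariant H W → W = ⊥ ∨ W = p i
  bracket_mem : ∀ i, ∀ X ∈ p i, ∀ Y ∈ p i, ⁅X, Y⁆ ∈ isotropyAlgebra n H

/-- `e i` is a basis of `p i`, orthonormal with respect to `-B`, for each `i`. -/
def AreOrthonormal [LieGroup (𝓡 m) ∞ G] {p : Fin 3 → Submodule ℝ (GroupLieAlgebra (𝓡 m) G)}
    {d : Fin 3 → ℕ} (e : ∀ i, Module.Basis (Fin (d i)) ℝ (p i)) : Prop :=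
  ∀ i α β, negKilling (e i α : GroupLieAlgebra (𝓡 m) G) (e i β) = if α = β then 1 else 0

/-- The constant `a_i = A / dim p_i`, where `A = ∑ ⟨[e_1^α, e_2^β], e_3^γ⟩²` is computed in
orthonormal bases of the three modules. -/
def wallachConstant [LieGroup (𝓡 m) ∞ G] {p : Fin 3 → Submodule ℝ (GroupLieAlgebra (𝓡 m) G)}
    {d : Fin 3 → ℕ} (e : ∀ i, Module.Basis (Fin (d i)) ℝ (p i)) (i : Fin 3) : ℝ :=
  (∑ α, ∑ β, ∑ γ,
    (negKilling ⁅(e 0 α : GroupLieAlgebra (𝓡 m) G), (e 1 β : GroupLieAlgebra (𝓡 m) G)⁆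
      (e 2 γ)) ^ 2) / d i

/-- `g` is the `G`-invariant Riemannian metric on `G ⧸ H` determined by the inner product
`x_1 ⟨·,·⟩|_{p_1} + x_2 ⟨·,·⟩|_{p_2} + x_3 ⟨·,·⟩|_{p_3}` with `⟨·,·⟩ = -B`, where the tangent space
at the base point is identified with `p_1 ⊕ p_2 ⊕ p_3` by the differential of the projection. -/
structure IsInvariantMetric [LieGroup (𝓡 m) ∞ G] {H : Subgroup G}
    [ChartedSpace (EuclideanSpace ℝ (Fin n)) (G ⧸ H)] [IsManifold (𝓡 n) ∞ (G ⧸ H)]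
    (p : Fin 3 → Submodule ℝ (GroupLieAlgebra (𝓡 m) G)) (x : Fin 3 → ℝ)
    (g : Metric n (G ⧸ H)) : Prop where
  pos : ∀ i, 0 < x i
  invariant : ∀ (a : G) (y : G ⧸ H) (v w : TangentSpace (𝓡 n) y),
    g.inner (a • y) (mfderiv (𝓡 n) (𝓡 n) (fun q : G ⧸ H => a • q) y v)
      (mfderiv (𝓡 n) (𝓡 n) (fun q : G ⧸ H => a • q) y w) = g.inner y v w
  diagonal : ∀ i j, ∀ X ∈ p i, ∀ Y ∈ p j,
    g.inner ((1 : G) : G ⧸ H) (dproj n H X) (dproj n H Y) =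
      if i = j then x i * negKilling X Y else 0

end Homogeneous

end Wallach

end

/-! Ricci curvature is computed with the Killing fields generated by the Lie algebra of `G`. For
such fields the Koszul formula (`inner_cov`) involves only brackets and the metric, and so does the
curvature (`inner_curvature`). At a point where the metric is diagonal in a `-B`-orthonormal frame,
taking the trace expresses Ric(e, e) through structure constants and the squared norms of the
𝔥-parts of brackets (`trace_curvature`). The identity -tr(ad(e)²) = 1 for a unit vector e eliminates
the latter (`killing_eq_sum_lie`). Since brackets within one module lie in 𝔥, only A survives, and
with all constants equal to 1/6 the sum of Ric(e, e) over a basis of p_i is dim p_i times r_i = 1/2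
+ (x_i² - x_j² - x_k²)/(12 x_j x_k) (`sum_ricci_eq`).

The individual entries of Ric are read off from the flow. The solution stays diagonal in the frame,
so the off-diagonal entries of Ric vanish, and all diagonal entries in p_i are determined by the one
function x_i and its derivative. They are therefore equal, and their average is r_i
(`ricci_moduleFrame_of_flow`).

What remains is the system x_i' = -2 r_i + 2 x_i S/n. On the face x_k = x_i + x_j one has r_i = r_j
= 1/3 and r_k = 2/3, so r_i + r_j - r_k vanishes; for a common constant a it would be 1/2 - 3a,
which is why 1/6 is the special value. Hence the scale-invariant quantity (x_i + x_j - x_k)/x_k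
satisfies a homogeneous linear equation w' = w b with b continuous and cannot reach zero
(`triangle_of_flow`). The triangle inequalities persist, and they make 12 x_j x_k r_i = 4 x_j x_k +
x_i² - (x_j - x_k)² positive (`ricciCoeff_pos`). -/

noncomputable section

namespace Wallach

/-! ### Lie brackets as commutators of derivations, and related vector fields. -/

section Bracket
open VectorField Filter
open scoped Topology
variable {E : Type*} [NormedAddCommGroup E] [NormedSpace ℝ E]
  {H : Type*} [TopologicalSpace H] {I : ModelWithCorners ℝ E H}
  {M : Type*} [TopologicalSpace M] [ChartedSpace H M]
  {F : Type*} [NormedAddCommGroup F] [NormedSpace ℝ F]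

/-- The directional derivative of a vector valued function along a vector field. -/
def dirDeriv (φ : M → F) (X : ∀ y : M, TangentSpace I y) (q : M) : F :=
  (mfderiv I 𝓘(ℝ, F) φ q : E →L[ℝ] F) (X q)

/-- A vector field, read in the chart at `x`. -/
def chartField (x : M) (X : ∀ y : M, TangentSpace I y) : E → E :=
  mpullbackWithin 𝓘(ℝ, E) I (extChartAt I x).symm X (range I)

variable [I.Boundaryless] [IsManifold I 2 M]

lemma fderiv_comp_extChartAt_symm {φ : M → F} {x : M} {u : E}
    (hu : u ∈ (extChartAt I x).target)
    (hφ : MDifferentiableAt I 𝓘(ℝ, F) φ ((extChartAt I x).symm u)) :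
    (fderiv ℝ (φ ∘ (extChartAt I x).symm) u : E →L[ℝ] F) =
      (mfderiv I 𝓘(ℝ, F) φ ((extChartAt I x).symm u) : E →L[ℝ] F).comp
        (mfderivWithin 𝓘(ℝ, E) I (extChartAt I x).symm (range I) u : E →L[ℝ] E) := by
  rw [← mfderiv_eq_fderiv, I.range_eq_univ, mfderivWithin_univ]
  apply mfderiv_comp u hφ
  have := mdifferentiableWithinAt_extChartAt_symm (I := I) hu
  rwa [I.range_eq_univ, mdifferentiableWithinAt_univ] at this

/-- The chain rule in a chart, which turns directional derivatives on the manifold into Fréchet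
derivatives on the model space. -/
lemma dirDeriv_extChartAt_symm {φ : M → F} {x : M} {u : E} (X : ∀ y : M, TangentSpace I y)
    (hu : u ∈ (extChartAt I x).target)
    (hφ : MDifferentiableAt I 𝓘(ℝ, F) φ ((extChartAt I x).symm u)) :
    dirDeriv φ X ((extChartAt I x).symm u) =
      fderiv ℝ (φ ∘ (extChartAt I x).symm) u (chartField x X u) := by
  rw [fderiv_comp_extChartAt_symm hu hφ]
  have := (isInvertible_mfderivWithin_extChartAt_symm (I := I) hu).self_comp_inverse
  have h2 := congrArg (fun L => L (X ((extChartAt I x).symm u))) this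
  exact congrArg _ h2.symm

lemma differentiableAt_chartField [CompleteSpace E] {x : M} {X : ∀ y : M, TangentSpace I y}
    (hX : MDifferentiableAt I I.tangent (fun y => (⟨y, X y⟩ : TangentBundle I M)) x) :
    DifferentiableAt ℝ (chartField x X) (extChartAt I x x) := by
  rw [← mdifferentiableWithinAt_univ] at hX
  have := hX.differentiableWithinAt_mpullbackWithin_vectorField
  rw [preimage_univ, univ_inter] at this
  have h : DifferentiableWithinAt ℝ (chartField x X) (range I) (extChartAt I x x) := this
  rwa [I.range_eq_univ, differentiableWithinAt_univ] at h

omit [IsManifold I 2 M] in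
lemma mlieBracket_eq_chartField {x : M} (X Y : ∀ y : M, TangentSpace I y) :
    mlieBracket I X Y x = (mfderiv I 𝓘(ℝ, E) (extChartAt I x) x : E →L[ℝ] E).inverse
      ((lieBracket ℝ (chartField x X) (chartField x Y) : E → E) (extChartAt I x x : E)) := by
  rw [mlieBracket, mlieBracketWithin_apply, preimage_univ, univ_inter]
  have h : (lieBracketWithin ℝ (chartField x X) (chartField x Y) (range I) : E → E)
      (extChartAt I x x : E) =
      (lieBracket ℝ (chartField x X) (chartField x Y) : E → E) (extChartAt I x x : E) := by
    rw [I.range_eq_univ, lieBracketWithin_univ]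
  exact congrArg (mfderiv I 𝓘(ℝ, E) (extChartAt I x) x : E →L[ℝ] E).inverse h

lemma mfderiv_extChartAt_eq_chartField {x : M} (X : ∀ y : M, TangentSpace I y) :
    (mfderiv I 𝓘(ℝ, E) (extChartAt I x) x : E →L[ℝ] E) (X x) =
      chartField x X (extChartAt I x x) := by
  have h := dirDeriv_extChartAt_symm (φ := extChartAt I x) (x := x) X (mem_extChartAt_target x)
    (by rw [extChartAt_to_inv]; exact mdifferentiableAt_extChartAt (mem_chart_source H x))
  rw [extChartAt_to_inv] at h
  refine h.trans ?_
  have : (extChartAt I x ∘ (extChartAt I x).symm) =ᶠ[𝓝 (extChartAt I x x)] id := by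
    filter_upwards [extChartAt_target_mem_nhds (I := I) x] with u hu
    exact (extChartAt I x).right_inv hu
  rw [this.fderiv_eq, fderiv_id]
  rfl

lemma dirDeriv_eventuallyEq {φ : M → F} {x : M} (hφ : ContMDiffAt I 𝓘(ℝ, F) 2 φ x)
    (Z : ∀ y : M, TangentSpace I y) :
    dirDeriv φ Z =ᶠ[𝓝 x] (fun u => fderiv ℝ (φ ∘ (extChartAt I x).symm) u (chartField x Z u)) ∘
      extChartAt I x := by
  filter_upwards [(contMDiffAt_iff_contMDiffAt_nhds (by decide)).1 hφ,
    extChartAt_source_mem_nhds (I := I) x] with q hq hqs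
  have h1 := (extChartAt I x).left_inv hqs
  have := dirDeriv_extChartAt_symm (φ := φ) (x := x) Z ((extChartAt I x).map_source hqs)
    (by rw [h1]; exact hq.mdifferentiableAt (by simp))
  rw [h1] at this
  exact this

omit [IsManifold I 2 M] in
lemma contDiffAt_comp_extChartAt_symm {φ : M → F} {x : M} (hφ : ContMDiffAt I 𝓘(ℝ, F) 2 φ x) :
    ContDiffAt ℝ 2 (φ ∘ (extChartAt I x).symm) (extChartAt I x x) := by
  have := (contMDiffAt_iff.1 hφ).2
  rw [I.range_eq_univ, contDiffWithinAt_univ] at this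
  exact this

lemma mdifferentiableAt_dirDeriv [CompleteSpace E] {φ : M → F} {x : M}
    {Z : ∀ y : M, TangentSpace I y} (hφ : ContMDiffAt I 𝓘(ℝ, F) 2 φ x)
    (hZ : MDifferentiableAt I I.tangent (fun y => (⟨y, Z y⟩ : TangentBundle I M)) x) :
    MDifferentiableAt I 𝓘(ℝ, F) (dirDeriv φ Z) x := by
  have hdψ := ((contDiffAt_comp_extChartAt_symm hφ).fderiv_right (m := 1)
    (by norm_num)).differentiableAt (by simp)
  have h1 := hdψ.clm_apply (differentiableAt_chartField hZ)
  exact (h1.mdifferentiableAt.comp x (mdifferentiableAt_extChartAt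
    (mem_chart_source H x))).congr_of_eventuallyEq (dirDeriv_eventuallyEq hφ Z)

/-- In a chart, each iterated derivative is a Hessian term plus the first derivative of `φ` along
the derivative of one field in the direction of the other. The Hessian is symmetric and cancels in
the commutator; what is left is the coordinate formula for the bracket. -/
theorem dirDeriv_mlieBracket [CompleteSpace E] {φ : M → F} {x : M} {X Y : ∀ y : M, TangentSpace I y}
    (hφ : ContMDiffAt I 𝓘(ℝ, F) 2 φ x)
    (hX : MDifferentiableAt I I.tangent (fun y => (⟨y, X y⟩ : TangentBundle I M)) x)
    (hY : MDifferentiableAt I I.tangent (fun y => (⟨y, Y y⟩ : TangentBundle I M)) x) :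
    dirDeriv φ (mlieBracket I X Y) x =
      dirDeriv (dirDeriv φ Y) X x - dirDeriv (dirDeriv φ X) Y x := by
  set e := extChartAt I x with he
  set u₀ := e x with hu₀
  set ψ : E → F := φ ∘ e.symm with hψ
  have hx : e.symm u₀ = x := extChartAt_to_inv x
  have ht : u₀ ∈ e.target := mem_extChartAt_target x
  have hψ2 : ContDiffAt ℝ 2 ψ u₀ := contDiffAt_comp_extChartAt_symm hφ
  have hφd : ∀ᶠ q in 𝓝 x, MDifferentiableAt I 𝓘(ℝ, F) φ q := by
    filter_upwards [(contMDiffAt_iff_contMDiffAt_nhds (by decide)).1 hφ] with q hq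
    exact hq.mdifferentiableAt (by simp)
  have hed : MDifferentiableAt I 𝓘(ℝ, E) e x := mdifferentiableAt_extChartAt (mem_chart_source H x)
  have hdψ : DifferentiableAt ℝ (fderiv ℝ ψ) u₀ :=
    (hψ2.fderiv_right (m := 1) (by norm_num)).differentiableAt (by simp)
  have second : ∀ Z W : ∀ y : M, TangentSpace I y,
      MDifferentiableAt I I.tangent (fun y => (⟨y, Z y⟩ : TangentBundle I M)) x →
      dirDeriv (dirDeriv φ Z) W x =
        fderiv ℝ (fderiv ℝ ψ) u₀ (chartField x W u₀) (chartField x Z u₀)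
        + fderiv ℝ ψ u₀ (fderiv ℝ (chartField x Z) u₀ (chartField x W u₀)) := by
    intro Z W hZ
    have h1 := hdψ.hasFDerivAt.clm_apply (differentiableAt_chartField hZ).hasFDerivAt
    have h2 := HasMFDerivAt.comp x h1.hasMFDerivAt hed.hasMFDerivAt
    have h3 := (h2.congr_of_eventuallyEq (dirDeriv_eventuallyEq hφ Z)).mfderiv
    have h4 : dirDeriv (dirDeriv φ Z) W x = _ := congrArg (fun L : E →L[ℝ] F => L (W x)) h3
    rw [h4, ← mfderiv_extChartAt_eq_chartField W]
    exact add_comm _ _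
  have hsymm : IsSymmSndFDerivAt ℝ ψ u₀ := hψ2.isSymmSndFDerivAt (by simp)
  have hbr : dirDeriv φ (mlieBracket I X Y) x =
      fderiv ℝ ψ u₀ (lieBracket ℝ (chartField x X) (chartField x Y) u₀) := by
    have h := dirDeriv_extChartAt_symm (φ := φ) (x := x) (mlieBracket I X Y) ht
      (by rw [hx]; exact hφd.self_of_nhds)
    rw [hx] at h
    rw [h, ← mfderiv_extChartAt_eq_chartField, mlieBracket_eq_chartField]
    have h5 := (isInvertible_mfderiv_extChartAt (I := I) (mem_extChartAt_source x)).self_comp_inverse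
    have h6 := congrArg (fun L : E →L[ℝ] E =>
      L (lieBracket ℝ (chartField x X) (chartField x Y) u₀)) h5
    exact congrArg _ h6
  rw [hbr, second Y X hY, second X Y hX, hsymm, lieBracket, map_sub]
  abel

variable {E' : Type*} [NormedAddCommGroup E'] [NormedSpace ℝ E']
  {H' : Type*} [TopologicalSpace H'] {I' : ModelWithCorners ℝ E' H'}
  {M' : Type*} [TopologicalSpace M'] [ChartedSpace H' M'] [I'.Boundaryless] [IsManifold I' 2 M']

/-- Lie brackets of `f`-related vector fields are `f`-related. -/
theorem mfderiv_mlieBracket_of_related [CompleteSpace E] [CompleteSpace E'] {f : M → M'} {x : M}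
    {X Y : ∀ y : M, TangentSpace I y} {X' Y' : ∀ y : M', TangentSpace I' y}
    (hf : ContMDiff I I' 2 f)
    (hX : MDifferentiableAt I I.tangent (fun y => (⟨y, X y⟩ : TangentBundle I M)) x)
    (hY : MDifferentiableAt I I.tangent (fun y => (⟨y, Y y⟩ : TangentBundle I M)) x)
    (hX' : MDifferentiableAt I' I'.tangent (fun y => (⟨y, X' y⟩ : TangentBundle I' M')) (f x))
    (hY' : MDifferentiableAt I' I'.tangent (fun y => (⟨y, Y' y⟩ : TangentBundle I' M')) (f x))
    (hXX : ∀ q, mfderiv I I' f q (X q) = X' (f q)) (hYY : ∀ q, mfderiv I I' f q (Y q) = Y' (f q)) :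
    mfderiv I I' f x (mlieBracket I X Y x) = mlieBracket I' X' Y' (f x) := by
  -- The chart at `f x` serves as a vector-valued test function: its differential there is
  -- injective, so it suffices to compare derivatives of `φ` along both vectors.
  set φ := extChartAt I' (f x) with hφ
  have hφ2 : ContMDiffAt I' 𝓘(ℝ, E') 2 φ (f x) := contMDiffAt_extChartAt
  have hφd : ∀ᶠ q in 𝓝 (f x), MDifferentiableAt I' 𝓘(ℝ, E') φ q := by
    filter_upwards [(contMDiffAt_iff_contMDiffAt_nhds (by decide)).1 hφ2] with q hq
    exact hq.mdifferentiableAt (by simp)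
  have hfd : MDifferentiable I I' f := hf.mdifferentiable (by simp)
  have hcomp : ∀ {Z : ∀ y : M, TangentSpace I y} {Z' : ∀ y : M', TangentSpace I' y}
      {g : M' → E'} {q : M}, MDifferentiableAt I' 𝓘(ℝ, E') g (f q) →
      mfderiv I I' f q (Z q) = Z' (f q) →
      dirDeriv (g ∘ f) Z q = dirDeriv g Z' (f q) := by
    intro Z Z' g q hg hZ
    rw [dirDeriv, dirDeriv, mfderiv_comp q hg (hfd q), ← hZ]
    rfl
  have hev : ∀ {Z : ∀ y : M, TangentSpace I y} {Z' : ∀ y : M', TangentSpace I' y},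
      (∀ q, mfderiv I I' f q (Z q) = Z' (f q)) →
      dirDeriv (φ ∘ f) Z =ᶠ[𝓝 x] dirDeriv φ Z' ∘ f := by
    intro Z Z' hZ
    filter_upwards [(hf.continuous.tendsto x).eventually hφd] with q hq
    exact hcomp hq (hZ q)
  have main := dirDeriv_mlieBracket (φ := φ ∘ f) (hφ2.comp x hf.contMDiffAt) hX hY
  have hsec : ∀ {Z W : ∀ y : M, TangentSpace I y} {Z' W' : ∀ y : M', TangentSpace I' y},
      MDifferentiableAt I' I'.tangent (fun y => (⟨y, Z' y⟩ : TangentBundle I' M')) (f x) →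
      (∀ q, mfderiv I I' f q (Z q) = Z' (f q)) → (∀ q, mfderiv I I' f q (W q) = W' (f q)) →
      dirDeriv (dirDeriv (φ ∘ f) Z) W x = dirDeriv (dirDeriv φ Z') W' (f x) := by
    intro Z W Z' W' hd hZ hW
    rw [dirDeriv, (hev hZ).mfderiv_eq]
    exact hcomp (mdifferentiableAt_dirDeriv hφ2 hd) (hW x)
  rw [hsec hY' hYY hXX, hsec hX' hXX hYY, ← dirDeriv_mlieBracket hφ2 hX' hY'] at main
  have h1 : dirDeriv (φ ∘ f) (mlieBracket I X Y) x =
      (mfderiv I' 𝓘(ℝ, E') φ (f x) : E' →L[ℝ] E') (mfderiv I I' f x (mlieBracket I X Y x)) := by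
    rw [dirDeriv, mfderiv_comp x hφd.self_of_nhds (hfd x)]
    rfl
  rw [h1] at main
  exact (isInvertible_mfderiv_extChartAt (I := I') (mem_extChartAt_source (f x))).injective main
end Bracket

/-! ### Derivatives between manifolds as maps of model spaces. -/

section Derivative
variable {E : Type*} [NormedAddCommGroup E] [NormedSpace ℝ E]
  {H : Type*} [TopologicalSpace H] (I : ModelWithCorners ℝ E H)
  {M : Type*} [TopologicalSpace M] [ChartedSpace H M]
  {E' : Type*} [NormedAddCommGroup E'] [NormedSpace ℝ E']
  {H' : Type*} [TopologicalSpace H'] (I' : ModelWithCorners ℝ E' H')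
  {M' : Type*} [TopologicalSpace M'] [ChartedSpace H' M']
  {E'' : Type*} [NormedAddCommGroup E''] [NormedSpace ℝ E'']
  {H'' : Type*} [TopologicalSpace H''] {I'' : ModelWithCorners ℝ E'' H''}
  {M'' : Type*} [TopologicalSpace M''] [ChartedSpace H'' M'']

/-- The derivative of a map between manifolds, as a linear map between the model spaces. Tangent
spaces at different points that are only propositionally equal are thus identified. -/
def mderiv (f : M → M') (x : M) : E →L[ℝ] E' := mfderiv I I' f x

variable {I I'}

lemma mderiv_comp {g : M' → M''} {f : M → M'} (x : M)
    (hg : MDifferentiableAt I' I'' g (f x)) (hf : MDifferentiableAt I I' f x) (v : E) :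
    mderiv I I'' (fun y => g (f y)) x v = mderiv I' I'' g (f x) (mderiv I I' f x v) :=
  congrArg (fun L : E →L[ℝ] E'' => L v) (mfderiv_comp x hg hf)

lemma mderiv_id (x : M) (v : E) : mderiv I I (fun y : M => y) x v = v :=
  congrArg (fun L : E →L[ℝ] E => L v) (mfderiv_id (I := I) (x := x))

lemma mderiv_const (c : M') (x : M) (v : E) : mderiv I I' (fun _ : M => c) x v = 0 :=
  congrArg (fun L : E →L[ℝ] E' => L v) (mfderiv_const (I := I) (I' := I') (c := c) (x := x))

lemma mderiv_prod {f : M × M' → M''} {p : M × M'}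
    (hf : MDifferentiableAt (I.prod I') I'' f p) (v : E × E') :
    mderiv (I.prod I') I'' f p v =
      mderiv I I'' (fun z => f (z, p.2)) p.1 v.1 + mderiv I' I'' (fun z => f (p.1, z)) p.2 v.2 :=
  mfderiv_prod_eq_add_apply hf
end Derivative

/-! ### Fundamental vector fields of a smooth action and their brackets. -/

section Action
open VectorField
variable {m n : ℕ} {G : Type*} [TopologicalSpace G] [ChartedSpace (EuclideanSpace ℝ (Fin m)) G]
  [Group G] {M : Type*} [TopologicalSpace M] [ChartedSpace (EuclideanSpace ℝ (Fin n)) M]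

/-- `act` is a smooth left action of `G` on `M`. -/
structure IsSmoothAction (m n : ℕ) {G : Type*} [TopologicalSpace G]
    [ChartedSpace (EuclideanSpace ℝ (Fin m)) G] [Group G] {M : Type*} [TopologicalSpace M]
    [ChartedSpace (EuclideanSpace ℝ (Fin n)) M] (act : G → M → M) : Prop where
  contMDiff : ContMDiff ((𝓡 m).prod (𝓡 n)) (𝓡 n) ∞ (fun q : G × M => act q.1 q.2)
  mul : ∀ a b y, act (a * b) y = act a (act b y)
  one : ∀ y, act 1 y = y

/-- The vector field on `M` generated by an element of the Lie algebra of `G`. -/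
def fundField (act : G → M → M) (X : GroupLieAlgebra (𝓡 m) G) (y : M) : TangentSpace (𝓡 n) y :=
  mderiv (𝓡 m) (𝓡 n) (fun b : G => act b y) 1 X

lemma fundField_add (act : G → M → M) (X Y : GroupLieAlgebra (𝓡 m) G) (y : M) :
    (fundField act (X + Y) y : TangentSpace (𝓡 n) y) = fundField act X y + fundField act Y y :=
  map_add (mderiv (𝓡 m) (𝓡 n) (fun b : G => act b y) 1) X Y

lemma fundField_smul (act : G → M → M) (c : ℝ) (X : GroupLieAlgebra (𝓡 m) G) (y : M) :
    (fundField act (c • X) y : TangentSpace (𝓡 n) y) = c • fundField act X y :=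
  map_smul (mderiv (𝓡 m) (𝓡 n) (fun b : G => act b y) 1) c X

namespace IsSmoothAction
variable {act : G → M → M} (h : IsSmoothAction m n act)
include h

lemma contMDiff_left (y : M) : ContMDiff (𝓡 m) (𝓡 n) ∞ (fun a => act a y) :=
  h.contMDiff.comp (contMDiff_id.prodMk contMDiff_const)

lemma contMDiff_right (a : G) : ContMDiff (𝓡 n) (𝓡 n) ∞ (act a) :=
  h.contMDiff.comp (contMDiff_const.prodMk contMDiff_id)

variable [LieGroup (𝓡 m) ∞ G]

/-- Differentiating (b a) · y = b · (a · y) in b at 1 shows that orbit maps relate right invariant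
fields to fundamental fields. -/
lemma mderiv_orbit (X : GroupLieAlgebra (𝓡 m) G) (a : G) (y : M) :
    mderiv (𝓡 m) (𝓡 n) (fun b => act b y) a (fundField (n := m) (fun b c : G => b * c) X a) =
      (fundField act X (act a y) : TangentSpace (𝓡 n) (act a y)) := by
  have h1 : (fun b => act b (act a y)) = fun b => act (b * a) y := by
    funext b; rw [h.mul]
  rw [fundField, fundField, h1]
  have h2 := (h.contMDiff_left y).mdifferentiable (by simp)
  have h3 := (contMDiff_mul_right (I := 𝓡 m) (n := ∞) (a := a)).mdifferentiable (by simp)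
  have := mderiv_comp (I := 𝓡 m) (I' := 𝓡 m) (I'' := 𝓡 n) (g := fun b => act b y)
    (f := fun b => b * a) (1 : G) (h2 _) (h3 _) X
  rw [one_mul] at this
  exact this.symm

variable [IsManifold (𝓡 n) ∞ M]

/-- The field is the tangent map of the action composed with y ↦ ((1, X), (y, 0)), and both are
smooth. -/
theorem isSmoothField_fundField (X : GroupLieAlgebra (𝓡 m) G) :
    IsSmoothField (n := n) (fun y : M => fundField act X y) := by
  have s0 : ContMDiff (𝓡 n) ((𝓡 n).prod (𝓡 n)) ∞
      (fun y : M => (⟨y, 0⟩ : TangentBundle (𝓡 n) M)) := contMDiff_zeroSection _ _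
  have sX : ContMDiff (𝓡 n) ((𝓡 m).prod (𝓡 m)) ∞
      (fun _ : M => (⟨1, X⟩ : TangentBundle (𝓡 m) G)) := contMDiff_const
  have S2 : ContMDiff _ _ ∞ (equivTangentBundleProd (𝓡 m) G (𝓡 n) M).symm :=
    contMDiff_equivTangentBundleProd_symm
  have S3 : ContMDiff _ _ ∞ (tangentMap ((𝓡 m).prod (𝓡 n)) (𝓡 n)
      (fun q : G × M => act q.1 q.2)) := h.contMDiff.contMDiff_tangentMap (m := ∞) le_rfl
  have S := (S3.comp S2).comp (sX.prodMk s0)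
  unfold IsSmoothField
  convert! S with y
  · simp [h.one]
  · have hd := h.contMDiff.mdifferentiable (by simp) ((1 : G), y)
    have := mderiv_prod hd (X, (0 : EuclideanSpace ℝ (Fin n)))
    rw [map_zero, add_zero] at this
    exact this.symm

lemma mdifferentiableAt_fundField (X : GroupLieAlgebra (𝓡 m) G) (y : M) :
    MDifferentiableAt (𝓡 n) (𝓡 n).tangent
      (fun y => (⟨y, fundField act X y⟩ : TangentBundle (𝓡 n) M)) y :=
  (h.isSmoothField_fundField X).mdifferentiable (by simp) y

end IsSmoothAction

section LeftRight
variable [LieGroup (𝓡 m) ∞ G]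

variable (m G) in
lemma isSmoothAction_mul : IsSmoothAction m m (fun a b : G => a * b) where
  contMDiff := contMDiff_mul (𝓡 m) ∞
  mul := mul_assoc
  one := one_mul

/-- The right invariant vector field on a Lie group. -/
abbrev rightField (X : GroupLieAlgebra (𝓡 m) G) (a : G) : TangentSpace (𝓡 m) a :=
  fundField (n := m) (fun b c : G => b * c) X a

omit [LieGroup (𝓡 m) ∞ G] in
lemma rightField_one (X : GroupLieAlgebra (𝓡 m) G) : rightField X 1 = X := by
  rw [rightField, fundField]
  have : (fun b : G => b * 1) = fun b => b := by funext b; exact mul_one b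
  rw [this]
  exact mderiv_id (I := 𝓡 m) (1 : G) (X : EuclideanSpace ℝ (Fin m))

lemma mdifferentiable_mul_left (a : G) :
    MDifferentiable (𝓡 m) (𝓡 m) (fun b : G => a * b) :=
  (contMDiff_mul_left (I := 𝓡 m) (n := ∞) (a := a)).mdifferentiable (by simp)

lemma mdifferentiable_mul_right (a : G) :
    MDifferentiable (𝓡 m) (𝓡 m) (fun b : G => b * a) :=
  (contMDiff_mul_right (I := 𝓡 m) (n := ∞) (a := a)).mdifferentiable (by simp)

/-- Obtained by differentiating b⁻¹ b = 1. -/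
lemma mderiv_inv_one (X : EuclideanSpace ℝ (Fin m)) :
    mderiv (𝓡 m) (𝓡 m) (fun b : G => b⁻¹) 1 X = -X := by
  have hinv : MDifferentiable (𝓡 m) (𝓡 m) (fun b : G => b⁻¹) :=
    (contMDiff_inv (𝓡 m) ∞).mdifferentiable (by simp)
  have hmul : MDifferentiable ((𝓡 m).prod (𝓡 m)) (𝓡 m) (fun p : G × G => p.1 * p.2) :=
    (contMDiff_mul (𝓡 m) ∞).mdifferentiable (by simp)
  have hp : MDifferentiableAt (𝓡 m) ((𝓡 m).prod (𝓡 m)) (fun b : G => (b⁻¹, b)) 1 :=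
    (hinv 1).prodMk mdifferentiableAt_id
  have h1 := mderiv_comp (I := 𝓡 m) (I' := (𝓡 m).prod (𝓡 m)) (I'' := 𝓡 m)
    (g := fun p : G × G => p.1 * p.2) (f := fun b : G => (b⁻¹, b)) 1 (hmul _) hp X
  have h2 : (fun b : G => ((b⁻¹, b) : G × G).1 * ((b⁻¹, b) : G × G).2) = fun _ => 1 := by
    funext b; simp
  rw [h2, mderiv_const, mderiv_prod (hmul _)] at h1
  have h3 : mderiv (𝓡 m) ((𝓡 m).prod (𝓡 m)) (fun b : G => (b⁻¹, b)) 1 X =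
      (mderiv (𝓡 m) (𝓡 m) (fun b : G => b⁻¹) 1 X, mderiv (𝓡 m) (𝓡 m) (fun b : G => b) 1 X) :=
    congrArg (fun L : EuclideanSpace ℝ (Fin m) →L[ℝ] EuclideanSpace ℝ (Fin m) ×
      EuclideanSpace ℝ (Fin m) => L X) (mfderiv_prodMk (hinv 1) mdifferentiableAt_id)
  rw [h3] at h1
  simp only [inv_one, mul_one, one_mul, mderiv_id] at h1
  exact eq_neg_of_add_eq_zero_left h1.symm

/-- Inversion exchanges left and right invariant fields, up to sign. -/
lemma mderiv_inv (X : GroupLieAlgebra (𝓡 m) G) (a : G) :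
    mderiv (𝓡 m) (𝓡 m) (fun b : G => b⁻¹) a (mulInvariantVectorField X a) =
      rightField (-X) a⁻¹ := by
  have hinv : MDifferentiable (𝓡 m) (𝓡 m) (fun b : G => b⁻¹) :=
    (contMDiff_inv (𝓡 m) ∞).mdifferentiable (by simp)
  have h1 := mderiv_comp (I := 𝓡 m) (I' := 𝓡 m) (I'' := 𝓡 m) (g := fun b : G => b⁻¹)
    (f := fun b : G => a * b) 1 (hinv _) (mdifferentiable_mul_left a 1) X
  have h2 := mderiv_comp (I := 𝓡 m) (I' := 𝓡 m) (I'' := 𝓡 m) (g := fun b : G => b * a⁻¹)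
    (f := fun b : G => b⁻¹) 1 (mdifferentiable_mul_right a⁻¹ _) (hinv _) X
  simp only [mul_inv_rev, inv_one, mul_one] at h1 h2
  rw [h1] at h2
  exact h2.trans (congrArg (mderiv (𝓡 m) (𝓡 m) (fun b : G => b * a⁻¹) 1)
    (mderiv_inv_one (G := G) X))

/-- Inversion relates the left invariant field of `X` to the right invariant field of `-X`. The two
signs cancel in the bracket, and the differential -1 of inversion at the identity leaves one minus
sign. -/
lemma mlieBracket_rightField_one (X Y : GroupLieAlgebra (𝓡 m) G) :
    mlieBracket (𝓡 m) (rightField X) (rightField Y) (1 : G) = -⁅X, Y⁆ := by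
  have hR : ∀ Z : GroupLieAlgebra (𝓡 m) G, ∀ b : G, MDifferentiableAt (𝓡 m) (𝓡 m).tangent
      (fun b => (⟨b, rightField Z b⟩ : TangentBundle (𝓡 m) G)) b := fun Z b =>
    (isSmoothAction_mul m G).mdifferentiableAt_fundField Z b
  have key := mfderiv_mlieBracket_of_related (I := 𝓡 m) (I' := 𝓡 m) (f := fun b : G => b⁻¹)
    (x := (1 : G)) (X := mulInvariantVectorField X) (Y := mulInvariantVectorField Y)
    (X' := rightField (-X)) (Y' := rightField (-Y))
    ((contMDiff_inv (𝓡 m) ∞).of_le ENat.LEInfty.out)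
    (mdifferentiableAt_mulInvariantVectorField X) (mdifferentiableAt_mulInvariantVectorField Y)
    (hR _ _) (hR _ _) (mderiv_inv X) (mderiv_inv Y)
  have hneg : ∀ Z : GroupLieAlgebra (𝓡 m) G, rightField (-Z) = (-1 : ℝ) • rightField Z := by
    intro Z; funext b
    rw [Pi.smul_apply, ← fundField_smul, neg_one_smul]
  have h1 : mlieBracket (𝓡 m) (rightField (-X)) (rightField (-Y)) (1 : G) =
      mlieBracket (𝓡 m) (rightField X) (rightField Y) (1 : G) := by
    rw [hneg, hneg, mlieBracket_const_smul_left (hR X 1), mlieBracket_const_smul_right (hR Y 1)]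
    simp
  rw [← h1]
  have h2 : mderiv (𝓡 m) (𝓡 m) (fun b : G => b⁻¹) 1
    (mlieBracket (𝓡 m) (mulInvariantVectorField X) (mulInvariantVectorField Y) (1 : G)) = _ := key
  rw [inv_one] at h2
  exact h2.symm.trans (mderiv_inv_one (G := G) (⁅X, Y⁆ : GroupLieAlgebra (𝓡 m) G))

/-- Left and right invariant vector fields commute (at the identity). -/
lemma mlieBracket_rightField_leftField_one (X Y : GroupLieAlgebra (𝓡 m) G) :
    mlieBracket (𝓡 m) (rightField X) (mulInvariantVectorField Y) (1 : G) = 0 := by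
  -- On G × G the fields (R_X, 0) and (0, L_Y) commute, because both projections annihilate their
  -- bracket. Multiplication relates them to R_X and L_Y.
  let A : ∀ p : G × G, TangentSpace ((𝓡 m).prod (𝓡 m)) p := fun p => (rightField X p.1, 0)
  let B : ∀ p : G × G, TangentSpace ((𝓡 m).prod (𝓡 m)) p :=
    fun p => (0, mulInvariantVectorField Y p.2)
  have hR : ∀ b : G, MDifferentiableAt (𝓡 m) (𝓡 m).tangent
      (fun b => (⟨b, rightField X b⟩ : TangentBundle (𝓡 m) G)) b := fun b =>
    (isSmoothAction_mul m G).mdifferentiableAt_fundField X b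
  have hL : ∀ b : G, MDifferentiableAt (𝓡 m) (𝓡 m).tangent
      (fun b => (⟨b, mulInvariantVectorField Y b⟩ : TangentBundle (𝓡 m) G)) b := fun b =>
    mdifferentiableAt_mulInvariantVectorField Y
  have h0 : ∀ b : G, MDifferentiableAt (𝓡 m) (𝓡 m).tangent
      (fun b => (⟨b, 0⟩ : TangentBundle (𝓡 m) G)) b := fun b =>
    mdifferentiableAt_zeroSection ℝ _
  have hS : MDifferentiable _ _ (equivTangentBundleProd (𝓡 m) G (𝓡 m) G).symm :=
    (contMDiff_equivTangentBundleProd_symm (n := 1)).mdifferentiable (by simp)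
  have hA : MDifferentiableAt ((𝓡 m).prod (𝓡 m)) ((𝓡 m).prod (𝓡 m)).tangent
      (fun p => (⟨p, A p⟩ : TangentBundle ((𝓡 m).prod (𝓡 m)) (G × G))) (1, 1) :=
    (hS _).comp (1, 1) (((hR 1).comp ((1 : G), (1 : G)) mdifferentiableAt_fst).prodMk
      ((h0 1).comp ((1 : G), (1 : G)) mdifferentiableAt_snd))
  have hB : MDifferentiableAt ((𝓡 m).prod (𝓡 m)) ((𝓡 m).prod (𝓡 m)).tangent
      (fun p => (⟨p, B p⟩ : TangentBundle ((𝓡 m).prod (𝓡 m)) (G × G))) (1, 1) :=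
    (hS _).comp (1, 1) (((h0 1).comp ((1 : G), (1 : G)) mdifferentiableAt_fst).prodMk
      ((hL 1).comp ((1 : G), (1 : G)) mdifferentiableAt_snd))
  have hmul : MDifferentiable ((𝓡 m).prod (𝓡 m)) (𝓡 m) (fun p : G × G => p.1 * p.2) :=
    (contMDiff_mul (𝓡 m) ∞).mdifferentiable (by simp)
  have dfst : ∀ (p : G × G) (v : EuclideanSpace ℝ (Fin m) × EuclideanSpace ℝ (Fin m)),
      mderiv ((𝓡 m).prod (𝓡 m)) (𝓡 m) (Prod.fst : G × G → G) p v = v.1 := fun p v =>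
    congrArg (fun L : EuclideanSpace ℝ (Fin m) × EuclideanSpace ℝ (Fin m) →L[ℝ]
      EuclideanSpace ℝ (Fin m) => L v) (mfderiv_fst (I := 𝓡 m) (I' := 𝓡 m) (x := p))
  have dsnd : ∀ (p : G × G) (v : EuclideanSpace ℝ (Fin m) × EuclideanSpace ℝ (Fin m)),
      mderiv ((𝓡 m).prod (𝓡 m)) (𝓡 m) (Prod.snd : G × G → G) p v = v.2 := fun p v =>
    congrArg (fun L : EuclideanSpace ℝ (Fin m) × EuclideanSpace ℝ (Fin m) →L[ℝ]
      EuclideanSpace ℝ (Fin m) => L v) (mfderiv_snd (I := 𝓡 m) (I' := 𝓡 m) (x := p))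
  set V : EuclideanSpace ℝ (Fin m) × EuclideanSpace ℝ (Fin m) :=
    mlieBracket ((𝓡 m).prod (𝓡 m)) A B (1, 1) with hV
  have k1 := mfderiv_mlieBracket_of_related (I := (𝓡 m).prod (𝓡 m)) (I' := 𝓡 m)
    (f := (Prod.fst : G × G → G)) (X := A) (Y := B) (X' := rightField X) (Y' := 0)
    contMDiff_fst hA hB (hR _) (h0 _) (fun p => dfst p _) (fun p => dfst p _)
  have k2 := mfderiv_mlieBracket_of_related (I := (𝓡 m).prod (𝓡 m)) (I' := 𝓡 m)
    (f := (Prod.snd : G × G → G)) (X := A) (Y := B) (X' := 0) (Y' := mulInvariantVectorField Y)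
    contMDiff_snd hA hB (h0 _) (hL _) (fun p => dsnd p _) (fun p => dsnd p _)
  have hV1 : V.1 = 0 := by
    rw [mlieBracket_zero_right] at k1
    exact (dfst (1, 1) V).symm.trans k1
  have hV2 : V.2 = 0 := by
    rw [mlieBracket_zero_left] at k2
    exact (dsnd (1, 1) V).symm.trans k2
  have hV0 : V = 0 := Prod.ext hV1 hV2
  have k3 := mfderiv_mlieBracket_of_related (I := (𝓡 m).prod (𝓡 m)) (I' := 𝓡 m)
    (f := fun p : G × G => p.1 * p.2) (X := A) (Y := B) (X' := rightField X)
    (Y' := mulInvariantVectorField Y) ((contMDiff_mul (𝓡 m) ∞).of_le ENat.LEInfty.out) hA hB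
    (hR _) (hL _) (fun p => ?_) (fun p => ?_)
  · have k4 : mderiv ((𝓡 m).prod (𝓡 m)) (𝓡 m) (fun p : G × G => p.1 * p.2) (1, 1) V = _ := k3
    rw [hV0, map_zero, mul_one] at k4
    exact k4.symm
  · have := mderiv_prod (hmul p) (rightField X p.1, (0 : EuclideanSpace ℝ (Fin m)))
    rw [map_zero, add_zero] at this
    exact this.trans ((isSmoothAction_mul m G).mderiv_orbit X p.1 p.2)
  · have := mderiv_prod (hmul p) ((0 : EuclideanSpace ℝ (Fin m)), mulInvariantVectorField Y p.2)
    rw [map_zero, zero_add] at this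
    refine this.trans ?_
    have h1 := mderiv_comp (I := 𝓡 m) (I' := 𝓡 m) (I'' := 𝓡 m) (g := fun b : G => p.1 * b)
      (f := fun b : G => p.2 * b) 1 (mdifferentiable_mul_left p.1 _)
      (mdifferentiable_mul_left p.2 _) Y
    simp only [mul_one, ← mul_assoc] at h1
    exact h1.symm
end LeftRight

/-- The orbit map through `y` carries right invariant fields to fundamental fields, so the sign is
that of the right invariant bracket. -/
theorem IsSmoothAction.mlieBracket_fundField [LieGroup (𝓡 m) ∞ G] [IsManifold (𝓡 n) ∞ M]
    {act : G → M → M} (h : IsSmoothAction m n act) (X Y : GroupLieAlgebra (𝓡 m) G) (y : M) :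
    mlieBracket (𝓡 n) (fundField act X) (fundField act Y) y = -fundField act ⁅X, Y⁆ y := by
  have hR := fun Z b => (isSmoothAction_mul m G).mdifferentiableAt_fundField Z b
  have key := mfderiv_mlieBracket_of_related (I := 𝓡 m) (I' := 𝓡 n) (f := fun b : G => act b y)
    (x := (1 : G)) (X := rightField X) (Y := rightField Y)
    (X' := fundField act X) (Y' := fundField act Y)
    ((h.contMDiff_left y).of_le ENat.LEInfty.out) (hR X 1) (hR Y 1)
    (h.mdifferentiableAt_fundField X _) (h.mdifferentiableAt_fundField Y _)
    (fun a => h.mderiv_orbit X a y) (fun a => h.mderiv_orbit Y a y)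
  have h2 : mderiv (𝓡 m) (𝓡 n) (fun b : G => act b y) 1
    (mlieBracket (𝓡 m) (rightField X) (rightField Y) (1 : G)) = _ := key
  rw [mlieBracket_rightField_one, h.one] at h2
  rw [← h2]
  exact map_neg (mderiv (𝓡 m) (𝓡 n) (fun b : G => act b y) 1) ⁅X, Y⁆
end Action

/-! ### The derivative of the adjoint action. -/

section Killing
open VectorField
variable {m n : ℕ} {G : Type*} [TopologicalSpace G] [ChartedSpace (EuclideanSpace ℝ (Fin m)) G]
  [Group G] {M : Type*} [TopologicalSpace M] [ChartedSpace (EuclideanSpace ℝ (Fin n)) M]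

/-- `a ↦ Ad(a⁻¹) Y`. -/
def adInv (Y : EuclideanSpace ℝ (Fin m)) (a : G) : EuclideanSpace ℝ (Fin m) :=
  mderiv (𝓡 m) (𝓡 m) (fun b : G => a⁻¹ * b * a) 1 Y

lemma adInv_one (Y : EuclideanSpace ℝ (Fin m)) : adInv Y (1 : G) = Y := by
  rw [adInv]
  simp only [inv_one, one_mul, mul_one]
  exact mderiv_id 1 Y

variable [LieGroup (𝓡 m) ∞ G]

lemma mdifferentiableAt_adInv (Y : EuclideanSpace ℝ (Fin m)) :
    MDifferentiableAt (𝓡 m) (𝓡 m) (adInv Y : G → EuclideanSpace ℝ (Fin m)) 1 := by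
  have hf : ContMDiff ((𝓡 m).prod (𝓡 m)) (𝓡 m) ∞
      (Function.uncurry fun a b : G => a⁻¹ * b * a) :=
    ((contMDiff_fst.inv).mul contMDiff_snd).mul contMDiff_fst
  have h := ContMDiffAt.mfderiv (m := 1) (x₀ := (1 : G)) (fun a b : G => a⁻¹ * b * a)
    (fun _ => (1 : G)) hf.contMDiffAt contMDiffAt_const
    (by rw [one_add_one_eq_two]; exact ENat.LEInfty.out)
  -- Every conjugation fixes 1, so all differentials act on the same tangent space and the
  -- coordinate changes are the identity.
  have h2 : inTangentCoordinates (𝓡 m) (𝓡 m) (fun _ : G => (1 : G)) (fun x : G => x⁻¹ * 1 * x)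
      (fun a => mderiv (𝓡 m) (𝓡 m) (fun b : G => a⁻¹ * b * a) 1) 1 =
      fun a => mderiv (𝓡 m) (𝓡 m) (fun b : G => a⁻¹ * b * a) 1 := by
    have h3 : (fun x : G => x⁻¹ * 1 * x) = fun _ => 1 := by funext x; simp
    rw [h3]
    funext a
    rw [inTangentCoordinates_eq (fun _ : G => (1 : G)) (fun _ : G => (1 : G)) _
      (mem_chart_source _ _) (mem_chart_source _ _)]
    ext v : 1
    simp only [ContinuousLinearMap.comp_apply]
    rw [(tangentBundleCore (𝓡 m) G).coordChange_self _ _ (mem_chart_source _ _),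
      (tangentBundleCore (𝓡 m) G).coordChange_self _ _ (mem_chart_source _ _)]
  have h4 : ContMDiffAt (𝓡 m) 𝓘(ℝ, EuclideanSpace ℝ (Fin m) →L[ℝ] EuclideanSpace ℝ (Fin m)) 1
    (fun a : G => mderiv (𝓡 m) (𝓡 m) (fun b : G => a⁻¹ * b * a) 1) 1 := h2 ▸ h
  exact (h4.mdifferentiableAt (by simp)).clm_apply mdifferentiableAt_const

lemma rightField_eq_leftField (Y : EuclideanSpace ℝ (Fin m)) (a : G) :
    rightField Y a = mulInvariantVectorField (I := 𝓡 m) (adInv Y a) a := by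
  have h0 : MDifferentiableAt (𝓡 m) (𝓡 m) (fun b : G => a⁻¹ * b * a) 1 :=
    ((contMDiff_const.mul contMDiff_id).mul contMDiff_const :
      ContMDiff (𝓡 m) (𝓡 m) ∞ (fun b : G => a⁻¹ * b * a)).mdifferentiable (by simp) 1
  have h1 := mderiv_comp (I := 𝓡 m) (I' := 𝓡 m) (I'' := 𝓡 m) (g := fun b : G => a * b)
    (f := fun b : G => a⁻¹ * b * a) 1 (mdifferentiable_mul_left a _) h0 Y
  have h2 : (fun b : G => a * (a⁻¹ * b * a)) = fun b => b * a := by funext b; group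
  simp only [mul_one, inv_mul_cancel] at h1
  rw [h2] at h1
  exact h1

omit [LieGroup (𝓡 m) ∞ G] in
lemma mulInvariantVectorField_eq_sum (v : EuclideanSpace ℝ (Fin m)) (a : G) :
    mulInvariantVectorField (I := 𝓡 m) v a =
      ∑ i, v i • mulInvariantVectorField (I := 𝓡 m) (G := G) (EuclideanSpace.basisFun (Fin m) ℝ i) a := by
  have h : v = ∑ i, v i • EuclideanSpace.basisFun (Fin m) ℝ i := by
    simpa using ((EuclideanSpace.basisFun (Fin m) ℝ).sum_repr v).symm
  have := congrArg (mderiv (𝓡 m) (𝓡 m) (fun b : G => a * b) 1) h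
  rw [map_sum] at this
  simp only [map_smul] at this
  exact this

/-- The derivative of `a ↦ Ad(a⁻¹) Y` at the identity. -/
lemma mderiv_adInv (X Y : GroupLieAlgebra (𝓡 m) G) :
    mderiv (𝓡 m) (𝓡 m) (adInv Y : G → EuclideanSpace ℝ (Fin m)) 1 X =
      (-⁅X, Y⁆ : GroupLieAlgebra (𝓡 m) G) := by
  let b : Fin m → EuclideanSpace ℝ (Fin m) := EuclideanSpace.basisFun (Fin m) ℝ
  let L : Fin m → ∀ a : G, TangentSpace (𝓡 m) a := fun i => mulInvariantVectorField (b i)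
  let c : Fin m → G → ℝ := fun i a => adInv Y a i
  have hc : ∀ i, HasMFDerivAt (𝓡 m) 𝓘(ℝ, ℝ) (c i) (1 : G)
      ((EuclideanSpace.proj i : EuclideanSpace ℝ (Fin m) →L[ℝ] ℝ).comp
        (mderiv (𝓡 m) (𝓡 m) (adInv Y : G → EuclideanSpace ℝ (Fin m)) 1)) := by
    intro i
    exact (EuclideanSpace.proj i : EuclideanSpace ℝ (Fin m) →L[ℝ] ℝ).hasFDerivAt.hasMFDerivAt.comp
      (1 : G) (mdifferentiableAt_adInv Y).hasMFDerivAt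
  have hL : ∀ i, MDifferentiableAt (𝓡 m) (𝓡 m).tangent
      (fun a => (⟨a, L i a⟩ : TangentBundle (𝓡 m) G)) 1 := fun i =>
    mdifferentiableAt_mulInvariantVectorField _
  have hRL : ∀ i, mlieBracket (𝓡 m) (rightField X) (L i) (1 : G) = 0 := fun i =>
    mlieBracket_rightField_leftField_one X (b i)
  have hL1 : ∀ i, L i 1 = b i := by
    intro i
    have : (fun a : G => 1 * a) = fun a => a := by funext a; exact one_mul a
    simp only [L, mulInvariantVectorField]
    rw [this]
    exact mderiv_id (I := 𝓡 m) (1 : G) (b i)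
  have hcL : ∀ i, MDifferentiableAt (𝓡 m) (𝓡 m).tangent
      (fun a => (⟨a, (c i • L i) a⟩ : TangentBundle (𝓡 m) G)) 1 := fun i =>
    (hc i).mdifferentiableAt.smul_section (hL i)
  -- R_Y = ∑ c_i L_i, where the c_i are the coordinates of Ad(a⁻¹)Y. Since R_X commutes with each
  -- L_i at 1, the bracket [R_X, R_Y] there only differentiates the coefficients.
  have hsum : ∀ s : Finset (Fin m), MDifferentiableAt (𝓡 m) (𝓡 m).tangent
        (fun a => (⟨a, (∑ i ∈ s, c i • L i) a⟩ : TangentBundle (𝓡 m) G)) 1 ∧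
      mlieBracket (𝓡 m) (rightField X) (∑ i ∈ s, c i • L i) (1 : G) =
        ∑ i ∈ s, (mderiv (𝓡 m) (𝓡 m) (adInv Y : G → EuclideanSpace ℝ (Fin m)) 1 X i) • b i := by
    intro s
    classical
    induction s using Finset.induction_on with
    | empty =>
      simp only [Finset.sum_empty]
      exact ⟨mdifferentiableAt_zeroSection ℝ _, by rw [mlieBracket_zero_right]; rfl⟩
    | insert i s hi ih =>
      rw [Finset.sum_insert hi, Finset.sum_insert hi]
      refine ⟨mdifferentiableAt_add_section (hcL i) ih.1, ?_⟩
      rw [mlieBracket_add_right (hcL i) ih.1, ih.2,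
        mlieBracket_smul_right (hc i).mdifferentiableAt (hL i), hRL i, smul_zero, add_zero,
        rightField_one, hL1 i]
      congr 2
      rw [mvfderiv, (hc i).mfderiv]
      rfl
  have hR : rightField Y = ∑ i, c i • L i := by
    funext a
    rw [Finset.sum_apply]
    exact (rightField_eq_leftField Y a).trans (mulInvariantVectorField_eq_sum _ a)
  have h := (hsum Finset.univ).2
  rw [← hR, mlieBracket_rightField_one] at h
  rw [h]
  simpa [b] using ((EuclideanSpace.basisFun (Fin m) ℝ).sum_repr
    (mderiv (𝓡 m) (𝓡 m) (adInv Y : G → EuclideanSpace ℝ (Fin m)) 1 X)).symm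
end Killing

/-! ### Isometric actions generate Killing fields. -/

section KillingFields
open VectorField
variable {n : ℕ} {M : Type*} [TopologicalSpace M] [ChartedSpace (EuclideanSpace ℝ (Fin n)) M]
  [IsManifold (𝓡 n) ∞ M]

lemma contMDiff_inner (g : Metric n M) {Y Z : ∀ y : M, TangentSpace (𝓡 n) y}
    (hY : IsSmoothField Y) (hZ : IsSmoothField Z) :
    ContMDiff (𝓡 n) 𝓘(ℝ, ℝ) ∞ (fun q => g.inner q (Y q) (Z q)) := by
  intro x
  have : ContMDiffAt (𝓡 n) ((𝓡 n).prod 𝓘(ℝ)) ∞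
      (fun q => TotalSpace.mk' ℝ (E := Bundle.Trivial M ℝ) q (g.inner q (Y q) (Z q))) x := by
    apply ContMDiffAt.clm_bundle_apply₂ (F₁ := EuclideanSpace ℝ (Fin n))
      (F₂ := EuclideanSpace ℝ (Fin n))
    · exact g.contMDiff x
    · exact hY x
    · exact hZ x
  rw [contMDiffAt_totalSpace] at this
  exact this.2

/-- A family of Killing fields, parametrized linearly by a Lie algebra, on which the bracket of
vector fields is the opposite of the bracket of the Lie algebra. -/
structure IsKillingFamily {L : Type*} [LieRing L] [LieAlgebra ℝ L] (g : Metric n M)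
    (K : L → ∀ y : M, TangentSpace (𝓡 n) y) : Prop where
  add : ∀ X Y y, K (X + Y) y = K X y + K Y y
  smul : ∀ (c : ℝ) X y, K (c • X) y = c • K X y
  smooth : ∀ X, IsSmoothField (K X)
  bracket : ∀ X Y y, mlieBracket (𝓡 n) (K X) (K Y) y = -K ⁅X, Y⁆ y
  killing : ∀ X Y Z y,
    (mfderiv (𝓡 n) 𝓘(ℝ, ℝ) (fun q => g.inner q (K Y q) (K Z q)) y (K X y) : ℝ) =
      -g.inner y (K ⁅X, Y⁆ y) (K Z y) - g.inner y (K Y y) (K ⁅X, Z⁆ y)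

variable {m : ℕ} {G : Type*} [TopologicalSpace G] [ChartedSpace (EuclideanSpace ℝ (Fin m)) G]
  [Group G] [LieGroup (𝓡 m) ∞ G]

/-- The generators of an isometric action are Killing fields. -/
theorem IsSmoothAction.isKillingFamily {act : G → M → M} (h : IsSmoothAction m n act)
    (g : Metric n M)
    (hinv : ∀ (a : G) (y : M) (v w : EuclideanSpace ℝ (Fin n)),
      g.inner (act a y) (mderiv (𝓡 n) (𝓡 n) (act a) y v) (mderiv (𝓡 n) (𝓡 n) (act a) y w) =
        g.inner y v w) :
    IsKillingFamily g (fundField (m := m) act) where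
  add := fundField_add act
  smul := fundField_smul act
  smooth := h.isSmoothField_fundField
  bracket := h.mlieBracket_fundField
  killing X Y Z y := by
    let D : EuclideanSpace ℝ (Fin m) →L[ℝ] EuclideanSpace ℝ (Fin n) :=
      mderiv (𝓡 m) (𝓡 n) (fun b : G => act b y) 1
    let g' : EuclideanSpace ℝ (Fin n) →L[ℝ] EuclideanSpace ℝ (Fin n) →L[ℝ] ℝ := g.inner y
    let Q : EuclideanSpace ℝ (Fin m) →L[ℝ] EuclideanSpace ℝ (Fin m) →L[ℝ] ℝ :=
      g'.bilinearComp D D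
    have hequiv : ∀ (U : EuclideanSpace ℝ (Fin m)) (a : G),
        mderiv (𝓡 n) (𝓡 n) (act a) y (D (adInv U a)) = fundField (m := m) act U (act a y) := by
      intro U a
      have h0 : MDifferentiableAt (𝓡 m) (𝓡 m) (fun b : G => a⁻¹ * b * a) 1 :=
        ((contMDiff_const.mul contMDiff_id).mul contMDiff_const :
          ContMDiff (𝓡 m) (𝓡 m) ∞ (fun b : G => a⁻¹ * b * a)).mdifferentiable (by simp) 1
      have h1 := mderiv_comp (I := 𝓡 m) (I' := 𝓡 m) (I'' := 𝓡 n) (g := fun b : G => act b y)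
        (f := fun b : G => a⁻¹ * b * a) 1 ((h.contMDiff_left y).mdifferentiable (by simp) _) h0 U
      have h2 := mderiv_comp (I := 𝓡 m) (I' := 𝓡 n) (I'' := 𝓡 n) (g := act a)
        (f := fun b : G => act (a⁻¹ * b * a) y) 1 ((h.contMDiff_right a).mdifferentiable (by simp) _)
        (((h.contMDiff_left y).mdifferentiable (by simp) _).comp (1 : G) h0) U
      have h3 : (fun b : G => act a (act (a⁻¹ * b * a) y)) = fun b => act b (act a y) := by
        funext b
        rw [← h.mul, ← h.mul]
        congr 1
        group
      rw [h3, h1] at h2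
      simp only [mul_one, inv_mul_cancel, h.one] at h2
      exact h2.symm
    -- Invariance pulls the metric back to `y`: along the orbit, g(K_Y, K_Z) becomes a fixed
    -- bilinear form evaluated at Ad(a⁻¹)Y and Ad(a⁻¹)Z. The product rule and `mderiv_adInv` then
    -- give its derivative.
    have hfun : (fun q => g.inner q (fundField (m := m) act Y q) (fundField (m := m) act Z q)) ∘
        (fun a : G => act a y) = fun a => Q (adInv Y a) (adInv Z a) := by
      funext a
      simp only [Function.comp_apply]
      have t := hinv a y (D (adInv Y a)) (D (adInv Z a))
      rw [hequiv Y a, hequiv Z a] at t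
      exact t
    have hY := (mdifferentiableAt_adInv (G := G) Y).hasMFDerivAt
    have hZ := (mdifferentiableAt_adInv (G := G) Z).hasMFDerivAt
    have hQ : mfderiv (𝓡 m) 𝓘(ℝ, ℝ) (fun a : G => Q (adInv Y a) (adInv Z a)) 1 X =
        Q Y (-⁅X, Z⁆ : GroupLieAlgebra (𝓡 m) G) + Q (-⁅X, Y⁆ : GroupLieAlgebra (𝓡 m) G) Z := by
      have hB : HasFDerivAt (fun p : EuclideanSpace ℝ (Fin m) × EuclideanSpace ℝ (Fin m) =>
          Q p.1 p.2) (Q.deriv₂ (adInv Y (1 : G), adInv Z (1 : G)))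
          (adInv Y (1 : G), adInv Z (1 : G)) := Q.isBoundedBilinearMap.hasFDerivAt _
      have hYZ : HasMFDerivAt (𝓡 m) 𝓘(ℝ, EuclideanSpace ℝ (Fin m) × EuclideanSpace ℝ (Fin m))
          (fun a : G => (adInv Y a, adInv Z a)) 1
          ((mderiv (𝓡 m) (𝓡 m) (adInv Y : G → EuclideanSpace ℝ (Fin m)) 1).prod
            (mderiv (𝓡 m) (𝓡 m) (adInv Z : G → EuclideanSpace ℝ (Fin m)) 1)) :=
        ⟨hY.1.prodMk hZ.1, hY.2.prodMk hZ.2⟩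
      have h1 := (hB.hasMFDerivAt.comp (1 : G) hYZ).mfderiv
      have h2 := congrArg (fun L : EuclideanSpace ℝ (Fin m) →L[ℝ] ℝ => L X) h1
      refine h2.trans ?_
      rw [← mderiv_adInv, ← mderiv_adInv]
      have e1 := adInv_one (G := G) Y
      have e2 := adInv_one (G := G) Z
      have h3 : ∀ v w : EuclideanSpace ℝ (Fin m),
          Q.deriv₂ (adInv Y (1 : G), adInv Z (1 : G)) (v, w) = Q Y w + Q v Z := by
        intro v w
        rw [ContinuousLinearMap.coe_deriv₂, e1, e2]
      exact h3 _ _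
    have hd : MDifferentiableAt (𝓡 n) 𝓘(ℝ, ℝ)
        (fun q => g.inner q (fundField (m := m) act Y q) (fundField (m := m) act Z q))
        (act 1 y) := (contMDiff_inner g (h.isSmoothField_fundField Y)
          (h.isSmoothField_fundField Z)).mdifferentiable (by simp) _
    have hc := mderiv_comp (I := 𝓡 m) (I' := 𝓡 n) (I'' := 𝓘(ℝ, ℝ)) (f := fun a : G => act a y)
      (g := fun q => g.inner q (fundField (m := m) act Y q) (fundField (m := m) act Z q))
      1 hd ((h.contMDiff_left y).mdifferentiable (by simp) _) X
    have hfun' : (fun a : G => g.inner (act a y) (fundField (m := m) act Y (act a y))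
      (fundField (m := m) act Z (act a y))) = fun a => Q (adInv Y a) (adInv Z a) := hfun
    rw [hfun', h.one] at hc
    have e1 : ∀ U V : EuclideanSpace ℝ (Fin m), Q U (-V) = -Q U V := fun U V => map_neg _ _
    have e2 : ∀ U V : EuclideanSpace ℝ (Fin m), Q (-U) V = -Q U V := fun U V => by
      rw [map_neg]; rfl
    refine hc.symm.trans (hQ.trans ?_)
    rw [show Q Y (-⁅X, Z⁆ : GroupLieAlgebra (𝓡 m) G) = -Q Y (⁅X, Z⁆ : GroupLieAlgebra (𝓡 m) G)
      from e1 _ _, show Q (-⁅X, Y⁆ : GroupLieAlgebra (𝓡 m) G) Z =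
      -Q (⁅X, Y⁆ : GroupLieAlgebra (𝓡 m) G) Z from e2 _ _, neg_add_eq_sub, ← neg_add_eq_sub,
      add_comm]
    rfl

end KillingFields

/-! ### Levi-Civita connection and curvature on Killing fields. -/

section Curvature
open VectorField
variable {n : ℕ} {M : Type*} [TopologicalSpace M] [ChartedSpace (EuclideanSpace ℝ (Fin n)) M]
  [IsManifold (𝓡 n) ∞ M]

lemma IsLeviCivita.isSmoothField {g : Metric n M} {cov : Connection n M} (h : IsLeviCivita g cov)
    {Y Z : ∀ y : M, TangentSpace (𝓡 n) y} (hY : IsSmoothField Y) (hZ : IsSmoothField Z) :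
    IsSmoothField (fun q => cov Z q (Y q)) := by
  intro x
  have h1 := h.smooth.contMDiff.contMDiff (σ := Z) hZ.contMDiffOn
  have h2 := (contMDiffOn_univ.1 h1) x
  exact ContMDiffAt.clm_bundle_apply (F₁ := EuclideanSpace ℝ (Fin n))
    (F₂ := EuclideanSpace ℝ (Fin n)) h2 (hY x)

variable {L : Type*} [LieRing L] [LieAlgebra ℝ L]

/-- The derivative of `g(A, B)` along `X`, for Killing fields `A`, `B`, `X`. -/
def killingDeriv (g : Metric n M) (K : L → ∀ y : M, TangentSpace (𝓡 n) y) (y : M) (X A B : L) : ℝ :=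
  -g.inner y (K ⁅X, A⁆ y) (K B y) - g.inner y (K A y) (K ⁅X, B⁆ y)

/-- The Koszul expression for `g(∇_X Y, Z)`, for Killing fields `X`, `Y`, `Z`. -/
def koszul (g : Metric n M) (K : L → ∀ y : M, TangentSpace (𝓡 n) y) (y : M) (X Y Z : L) : ℝ :=
  -(g.inner y (K ⁅X, Y⁆ y) (K Z y) + g.inner y (K ⁅X, Z⁆ y) (K Y y)
    + g.inner y (K X y) (K ⁅Y, Z⁆ y)) / 2

namespace IsKillingFamily
variable {g : Metric n M} {K : L → ∀ y : M, TangentSpace (𝓡 n) y} (hK : IsKillingFamily g K)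
  {cov : Connection n M} (hcov : IsLeviCivita g cov)
include hK

lemma neg (X : L) (y : M) : K (-X) y = -K X y := by
  rw [← neg_one_smul ℝ X, hK.smul, neg_one_smul]

lemma lie_swap (X Y : L) (y : M) : K ⁅X, Y⁆ y = -K ⁅Y, X⁆ y := by
  rw [← lie_skew X Y, hK.neg]

include hcov

lemma torsion (X Y : L) (y : M) :
    cov (K Y) y (K X y) - cov (K X) y (K Y y) = -K ⁅X, Y⁆ y := by
  rw [← hK.bracket]
  exact cov.torsion_eq_zero_iff.1 hcov.torsion_eq_zero
    ((hK.smooth X).mdifferentiable (by simp) y) ((hK.smooth Y).mdifferentiable (by simp) y)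

lemma metric (X Y Z : L) (y : M) : killingDeriv g K y X Y Z =
    g.inner y (cov (K Y) y (K X y)) (K Z y) + g.inner y (K Y y) (cov (K Z) y (K X y)) :=
  (hK.killing X Y Z y).symm.trans (hcov.metric _ _ (hK.smooth Y) (hK.smooth Z) y (K X y))

/-- The usual Koszul argument: the metric identity in three cyclic orders, combined with vanishing
torsion. For Killing fields the derivatives of the metric are themselves bracket terms. -/
theorem inner_cov (X Y Z : L) (y : M) :
    g.inner y (cov (K Y) y (K X y)) (K Z y) = koszul g K y X Y Z := by
  have m1 := hK.metric hcov X Y Z y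
  have m2 := hK.metric hcov Y Z X y
  have m3 := hK.metric hcov Z X Y y
  have t : ∀ A B C : L, g.inner y (cov (K B) y (K A y)) (K C y) -
      g.inner y (cov (K A) y (K B y)) (K C y) = -g.inner y (K ⁅A, B⁆ y) (K C y) := by
    intro A B C
    have := congrArg (fun v => g.inner y v (K C y)) (hK.torsion hcov A B y)
    simpa only [map_sub, map_neg, sub_apply, neg_apply]
      using this
  have t1 := t X Y Z
  have t2 := t Y Z X
  have t3 := t Z X Y
  have s : ∀ A B C : L, g.inner y (K ⁅A, B⁆ y) (K C y) = -g.inner y (K ⁅B, A⁆ y) (K C y) := by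
    intro A B C
    rw [hK.lie_swap A B, map_neg]; rfl
  have s1 := s X Y Z
  have s2 := s Y Z X
  have s3 := s Z X Y
  simp only [killingDeriv, g.symm y (K _ y) (K ⁅_, _⁆ y), g.symm y (K _ y) (cov _ y _)]
    at m1 m2 m3
  simp only [koszul, g.symm y (K _ y) (K ⁅_, _⁆ y)]
  linarith

/-- The Koszul expression for g(∇_Y Z, W) holds at every point, so it may be differentiated along X.
Metric compatibility turns this into g(∇_X ∇_Y Z, W) + g(∇_Y Z, ∇_X W), which yields the second
covariant derivatives. -/
theorem inner_curvature {R : ∀ y : M, TangentSpace (𝓡 n) y →ₗ[ℝ] TangentSpace (𝓡 n) y →ₗ[ℝ]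
      TangentSpace (𝓡 n) y →ₗ[ℝ] TangentSpace (𝓡 n) y} (hR : IsCurvatureTensor cov R)
    (X Y Z W : L) (y : M) :
    g.inner y (R y (K X y) (K Y y) (K Z y)) (K W y) =
      -(killingDeriv g K y X ⁅Y, Z⁆ W + killingDeriv g K y X ⁅Y, W⁆ Z
        + killingDeriv g K y X Y ⁅Z, W⁆) / 2
      - g.inner y (cov (K Z) y (K Y y)) (cov (K W) y (K X y))
      + (killingDeriv g K y Y ⁅X, Z⁆ W + killingDeriv g K y Y ⁅X, W⁆ Z
        + killingDeriv g K y Y X ⁅Z, W⁆) / 2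
      + g.inner y (cov (K Z) y (K X y)) (cov (K W) y (K Y y))
      + koszul g K y ⁅X, Y⁆ Z W := by
  have key : ∀ A B : L, g.inner y (cov (fun q => cov (K Z) q (K B q)) y (K A y)) (K W y) =
      -(killingDeriv g K y A ⁅B, Z⁆ W + killingDeriv g K y A ⁅B, W⁆ Z
        + killingDeriv g K y A B ⁅Z, W⁆) / 2
      - g.inner y (cov (K Z) y (K B y)) (cov (K W) y (K A y)) := by
    intro A B
    have h1 := hcov.metric _ _ (hcov.isSmoothField (hK.smooth B) (hK.smooth Z)) (hK.smooth W) y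
      (K A y)
    have h2 : (fun q => g.inner q (cov (K Z) q (K B q)) (K W q)) =
        fun q => (-1/2 : ℝ) * (g.inner q (K ⁅B, Z⁆ q) (K W q) + g.inner q (K ⁅B, W⁆ q) (K Z q)
          + g.inner q (K B q) (K ⁅Z, W⁆ q)) := by
      funext q
      rw [hK.inner_cov hcov, koszul]
      ring
    let df : L → L → EuclideanSpace ℝ (Fin n) →L[ℝ] ℝ := fun U V =>
      mderiv (𝓡 n) 𝓘(ℝ, ℝ) (fun q => g.inner q (K U q) (K V q)) y
    have d : ∀ U V : L, HasMFDerivAt (𝓡 n) 𝓘(ℝ, ℝ) (fun q => g.inner q (K U q) (K V q)) y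
        (df U V) := fun U V =>
      ((contMDiff_inner g (hK.smooth U) (hK.smooth V)).mdifferentiable (by simp) y).hasMFDerivAt
    have dK : ∀ U V : L, df U V (K A y) = killingDeriv g K y A U V := fun U V =>
      hK.killing A U V y
    have h3 : HasMFDerivAt (𝓡 n) 𝓘(ℝ, ℝ) (fun q => (-1/2 : ℝ) *
        (g.inner q (K ⁅B, Z⁆ q) (K W q) + g.inner q (K ⁅B, W⁆ q) (K Z q)
          + g.inner q (K B q) (K ⁅Z, W⁆ q))) y
        ((-1/2 : ℝ) • (df ⁅B, Z⁆ W + df ⁅B, W⁆ Z + df B ⁅Z, W⁆)) :=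
      (((d ⁅B, Z⁆ W).add (d ⁅B, W⁆ Z)).add (d B ⁅Z, W⁆)).const_smul (-1/2 : ℝ)
    have h4 : mderiv (𝓡 n) 𝓘(ℝ, ℝ) (fun q => g.inner q (cov (K Z) q (K B q)) (K W q)) y (K A y) =
        (-1/2 : ℝ) * (df ⁅B, Z⁆ W (K A y) + df ⁅B, W⁆ Z (K A y) + df B ⁅Z, W⁆ (K A y)) := by
      rw [h2]
      exact congrArg (fun T : EuclideanSpace ℝ (Fin n) →L[ℝ] ℝ => T (K A y)) h3.mfderiv
    rw [dK, dK, dK] at h4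
    have h5 := h4.symm.trans h1
    linarith
  rw [hR _ _ _ (hK.smooth X) (hK.smooth Y) (hK.smooth Z), hK.bracket, map_sub, map_sub, map_neg]
  have e : g.inner y (-cov (K Z) y (K ⁅X, Y⁆ y)) (K W y) = -koszul g K y ⁅X, Y⁆ Z W := by
    rw [map_neg, ← hK.inner_cov hcov]; rfl
  have e' : ∀ u v w : TangentSpace (𝓡 n) y,
    (g.inner y u - g.inner y v - g.inner y w) (K W y) = g.inner y u (K W y)
      - g.inner y v (K W y) - g.inner y w (K W y) := fun _ _ _ => rfl
  rw [e', e, key X Y, key Y X]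
  ring
end IsKillingFamily
end Curvature

/-! ### Traces and inner products in an orthogonal basis. -/

section OrthogonalBasis
variable {V J : Type*} [AddCommGroup V] [Module ℝ V] [Fintype J] [DecidableEq J]
  (b : Module.Basis J ℝ V) (G : V →ₗ[ℝ] V →ₗ[ℝ] ℝ) {x : J → ℝ}

lemma repr_eq_of_orthogonal (hG : ∀ i j, G (b i) (b j) = if i = j then x i else 0)
    (v : V) (i : J) : G v (b i) = b.repr v i * x i := by
  have h := congrArg (fun w => G w (b i)) (b.sum_repr v)
  simp only [map_sum, LinearMap.sum_apply, map_smul, LinearMap.smul_apply, hG, smul_eq_mul,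
    mul_ite, mul_zero, Finset.sum_ite_eq', Finset.mem_univ, if_true] at h
  exact h.symm

lemma trace_eq_of_orthogonal (hG : ∀ i j, G (b i) (b j) = if i = j then x i else 0)
    (hx : ∀ i, 0 < x i) (f : V →ₗ[ℝ] V) :
    LinearMap.trace ℝ V f = ∑ i, G (f (b i)) (b i) / x i := by
  rw [LinearMap.trace_eq_matrix_trace ℝ b, Matrix.trace]
  refine Finset.sum_congr rfl fun i _ => ?_
  rw [repr_eq_of_orthogonal b G hG, Matrix.diag_apply, LinearMap.toMatrix_apply,
    mul_div_cancel_right₀ _ (hx i).ne']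

lemma parseval_of_orthogonal (hG : ∀ i j, G (b i) (b j) = if i = j then x i else 0)
    (hx : ∀ i, 0 < x i) (v w : V) :
    G v w = ∑ i, G v (b i) * G w (b i) / x i := by
  conv_lhs => rw [← b.sum_repr w]
  rw [map_sum]
  refine Finset.sum_congr rfl fun i _ => ?_
  rw [map_smul, smul_eq_mul, repr_eq_of_orthogonal b G hG w]
  field_simp [(hx i).ne']
end OrthogonalBasis

/-! ### Ricci curvature of a metric diagonal in a frame of Killing fields. -/

section Ricci
variable {n : ℕ} {M : Type*} [TopologicalSpace M] [ChartedSpace (EuclideanSpace ℝ (Fin n)) M]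
  [IsManifold (𝓡 n) ∞ M] {L : Type*} [LieRing L] [LieAlgebra ℝ L]
  {J : Type*} [Fintype J] [DecidableEq J]

/-- At the point `y`, the Killing fields `K (e c)` form an orthogonal basis, and the metric is
diagonal with respect to the invariant form `B`. -/
structure IsDiagonalAt (g : Metric n M) (K : L → ∀ y : M, TangentSpace (𝓡 n) y) (y : M)
    (B : LinearMap.BilinForm ℝ L) (e : J → L) (x : J → ℝ) : Prop where
  symm : ∀ U V, B U V = B V U
  lie : ∀ U V W, B ⁅U, V⁆ W = B U ⁅V, W⁆
  orthonormal : ∀ a b, B (e a) (e b) = if a = b then 1 else 0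
  pos : ∀ a, 0 < x a
  inner : ∀ U V, g.inner y (K U y) (K V y) = ∑ c, x c * (B U (e c) * B V (e c))
  surjective : ∀ v : TangentSpace (𝓡 n) y, ∃ U, K U y = v

namespace IsDiagonalAt
variable {g : Metric n M} {K : L → ∀ y : M, TangentSpace (𝓡 n) y} {y : M}
  {B : LinearMap.BilinForm ℝ L} {e : J → L} {x : J → ℝ}
  (hD : IsDiagonalAt g K y B e x) (hK : IsKillingFamily g K)
include hD

lemma inner_right (U : L) (a : J) : g.inner y (K U y) (K (e a) y) = x a * B U (e a) := by
  rw [hD.inner]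
  simp [hD.orthonormal]

lemma inner_basis (a b : J) : g.inner y (K (e a) y) (K (e b) y) = if a = b then x a else 0 := by
  rw [hD.inner_right, hD.orthonormal]
  split_ifs with h
  · rw [h, mul_one]
  · rw [mul_zero]

/-- By the diagonal formula, the vector has length zero. -/
lemma map_proj_eq_zero (U : L) : K (U - ∑ c, B U (e c) • e c) y = 0 := by
  by_contra h
  have := g.pos y _ h
  rw [hD.inner] at this
  simp [map_sub, map_sum, LinearMap.sub_apply, LinearMap.sum_apply, hD.orthonormal] at this

include hK in
lemma map_eq_sum (U : L) : K U y = ∑ c, B U (e c) • K (e c) y := by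
  let Kl : L →ₗ[ℝ] TangentSpace (𝓡 n) y :=
    { toFun := fun U => K U y
      map_add' := fun U V => hK.add U V y
      map_smul' := fun c U => hK.smul c U y }
  have h : Kl (U - ∑ c, B U (e c) • e c) = 0 := hD.map_proj_eq_zero U
  rw [map_sub, map_sum, sub_eq_zero] at h
  simp only [map_smul] at h
  exact h

include hK in
lemma exists_basis : ∃ b : Module.Basis J ℝ (TangentSpace (𝓡 n) y), ∀ a, b a = K (e a) y := by
  have hli : LinearIndependent ℝ (fun a => K (e a) y) := by
    rw [Fintype.linearIndependent_iff]
    intro f hf i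
    have h := congrArg (fun v => g.inner y v (K (e i) y)) hf
    simp only [map_sum, map_smul, map_zero, sum_apply, smul_apply,
      zero_apply, hD.inner_basis, smul_eq_mul, mul_ite, mul_zero,
      Finset.sum_ite_eq', Finset.mem_univ, if_true] at h
    exact (mul_eq_zero.1 h).resolve_right (hD.pos i).ne'
  refine ⟨Module.Basis.mk hli fun v _ => ?_, fun a => by simp⟩
  obtain ⟨U, rfl⟩ := hD.surjective v
  rw [hD.map_eq_sum hK U]
  exact Submodule.sum_mem _ fun c _ => Submodule.smul_mem _ _ (Submodule.subset_span ⟨c, rfl⟩)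

include hK in
/-- If two directions are not scaled by the same factor, the isotropy algebra does not mix them. -/
lemma mul_defect_eq_zero (a b : J) :
    (x a - x b) * (B ⁅e b, e a⁆ ⁅e b, e a⁆ - ∑ c, B ⁅e b, e a⁆ (e c) ^ 2) = 0 := by
  set u := ⁅e b, e a⁆ with hu
  set Z := u - ∑ c, B u (e c) • e c with hZ
  -- The part of u orthogonal to the frame generates a field vanishing at `y`, so the Killing
  -- equation in that direction has zero left-hand side.
  have hZ0 : K Z y = 0 := hD.map_proj_eq_zero u
  have h : killingDeriv g K y Z (e b) (e a) = 0 := by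
    have := hK.killing Z (e b) (e a) y
    rw [hZ0, map_zero] at this
    exact this.symm
  rw [killingDeriv, hD.inner_right, g.symm, hD.inner_right, hD.lie, hD.lie,
    ← lie_skew (e a) (e b), map_neg, ← hu] at h
  have hB : B Z u = B u u - ∑ c, B u (e c) ^ 2 := by
    rw [hZ]
    simp only [map_sub, map_sum, map_smul, LinearMap.sub_apply, LinearMap.sum_apply,
      LinearMap.smul_apply, smul_eq_mul, sq]
    congr 1
    exact Finset.sum_congr rfl fun c _ => by rw [hD.symm (e c)]
  rw [← hB]
  linarith

lemma lie_self_right (U V : L) : B ⁅U, V⁆ U = 0 := by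
  have h1 := hD.lie U V U
  have h2 := hD.symm U ⁅V, U⁆
  rw [← lie_skew U V, map_neg] at h1
  simp only [LinearMap.neg_apply] at h1
  have h3 := hD.lie V U U
  rw [lie_self, map_zero] at h3
  rw [← lie_skew, map_neg, LinearMap.neg_apply, h3, neg_zero]

/-- The metric at `y` as a bilinear form. -/
def metricForm (g : Metric n M) (y : M) :
    TangentSpace (𝓡 n) y →ₗ[ℝ] TangentSpace (𝓡 n) y →ₗ[ℝ] ℝ :=
  LinearMap.mk₂ ℝ (fun v w => g.inner y v w) (fun _ _ _ => by rw [map_add]; rfl)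
    (fun _ _ _ => by rw [map_smul]; rfl) (fun _ _ _ => map_add _ _ _) (fun _ _ _ => map_smul _ _ _)

include hK

theorem inner_curvature_basis {cov : Connection n M} (hcov : IsLeviCivita g cov)
    {R : ∀ y : M, TangentSpace (𝓡 n) y →ₗ[ℝ] TangentSpace (𝓡 n) y →ₗ[ℝ]
      TangentSpace (𝓡 n) y →ₗ[ℝ] TangentSpace (𝓡 n) y} (hR : IsCurvatureTensor cov R) (a b : J) :
    g.inner y (R y (K (e b) y) (K (e a) y) (K (e a) y)) (K (e b) y) =
      (B ⁅e b, e a⁆ ⁅e b, e a⁆ - ∑ c, B ⁅e b, e a⁆ (e c) ^ 2) * x b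
      + ∑ c, B ⁅e b, e a⁆ (e c) ^ 2 *
        ((x a + x b - x c) / 2 - x c / 4 + (x a - x b) ^ 2 / (4 * x c)) := by
  obtain ⟨bas, hbas⟩ := hD.exists_basis hK
  have hdef := hD.mul_defect_eq_zero hK a b
  have hpars := fun v w => parseval_of_orthogonal bas (metricForm g y) (x := x)
    (fun i j => by rw [hbas, hbas]; exact hD.inner_basis i j) hD.pos v w
  simp only [hbas] at hpars
  change ∀ v w, g.inner y v w = ∑ c, g.inner y v (K (e c) y) * g.inner y w (K (e c) y) / x c
    at hpars
  rw [hK.inner_curvature hcov hR]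
  set u := ⁅e b, e a⁆ with hu
  have hu' : ⁅e a, e b⁆ = -u := by rw [hu, lie_skew]
  have q0 : ∀ V, g.inner y (K (0 : L) y) (K V y) = 0 := by
    intro V; rw [hD.inner]; simp
  have qn : ∀ U V, g.inner y (K (-U) y) (K V y) = -g.inner y (K U y) (K V y) := by
    intro U V; rw [hD.inner, hD.inner]; simp
  have qn' : ∀ U V, g.inner y (K V y) (K (-U) y) = -g.inner y (K V y) (K U y) := by
    intro U V; rw [hD.inner, hD.inner]; simp
  have ql : ∀ U c, g.inner y (K (e c) y) (K U y) = x c * B U (e c) := by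
    intro U c; rw [g.symm, hD.inner_right]
  have b1 : B ⁅e b, u⁆ (e a) = -B u u := by
    rw [← lie_skew, map_neg, LinearMap.neg_apply, hD.lie]
  have b2 : B ⁅u, e a⁆ (e b) = -B u u := by
    rw [hD.lie, hu', map_neg]
  have b3 : B ⁅u, e b⁆ (e a) = B u u := by rw [hD.lie]
  have b4 : B ⁅e a, u⁆ (e b) = B u u := by
    rw [← lie_skew, map_neg, LinearMap.neg_apply, b2, neg_neg]
  have haa : ∀ Z, koszul g K y (e a) (e a) Z = 0 := by
    intro Z
    rw [koszul, lie_self, q0, ql, hD.inner_right, hD.lie_self_right]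
    simp
  have hba : ∀ c, koszul g K y (e b) (e a) (e c) =
      -(x c - x a + x b) / 2 * B u (e c) := by
    intro c
    rw [koszul, ← hu, hD.inner_right, hD.inner_right, ql]
    have c1 : B ⁅e b, e c⁆ (e a) = -B u (e c) := by
      rw [← lie_skew, map_neg, LinearMap.neg_apply, hD.lie, ← hu, hD.symm]
    have c2 : B ⁅e a, e c⁆ (e b) = B u (e c) := by
      rw [← lie_skew, map_neg, LinearMap.neg_apply, hD.lie, hu', map_neg, neg_neg, hD.symm]
    rw [c1, c2]; ring
  have hab : ∀ c, koszul g K y (e a) (e b) (e c) =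
      (x c - x b + x a) / 2 * B u (e c) := by
    intro c
    rw [koszul, hu', qn, hD.inner_right, hD.inner_right, ql]
    have c1 : B ⁅e b, e c⁆ (e a) = -B u (e c) := by
      rw [← lie_skew, map_neg, LinearMap.neg_apply, hD.lie, ← hu, hD.symm]
    have c2 : B ⁅e a, e c⁆ (e b) = B u (e c) := by
      rw [← lie_skew, map_neg, LinearMap.neg_apply, hD.lie, hu', map_neg, neg_neg, hD.symm]
    rw [c1, c2]; ring
  have hub : koszul g K y u (e a) (e b) =
      ((x b - x a) * B u u + g.inner y (K u y) (K u y)) / 2 := by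
    rw [koszul, hu', qn', hD.inner_right, hD.inner_right, b2, b3]; ring
  rw [hub, hpars (cov (K (e a)) y (K (e a) y)), hpars (cov (K (e a)) y (K (e b) y))]
  simp only [hK.inner_cov hcov, haa, hab, hba, killingDeriv, lie_self, hu', lie_neg, lie_zero, q0,
    qn, qn', ← hu, hD.inner_right, ql, b1, b4, zero_mul, zero_div, Finset.sum_const_zero]
  rw [hD.inner u u]
  have e1 : ∑ c, B u (e c) ^ 2 * ((x a + x b - x c) / 2 - x c / 4 + (x a - x b) ^ 2 / (4 * x c)) =
      (x a + x b) / 2 * ∑ c, B u (e c) ^ 2 - (∑ c, x c * (B u (e c) * B u (e c))) / 2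
      + ∑ c, -(x c - x a + x b) / 2 * B u (e c) * ((x c - x b + x a) / 2 * B u (e c)) / x c := by
    rw [Finset.mul_sum, Finset.sum_div, ← Finset.sum_sub_distrib, ← Finset.sum_add_distrib]
    refine Finset.sum_congr rfl fun c _ => ?_
    field_simp [(hD.pos c).ne']
    ring
  rw [e1]
  -- The computation weights the squared norm of the 𝔥-part of u by (x_a + x_b)/2, the statement by
  -- x_b. By `mul_defect_eq_zero` the difference vanishes.
  linear_combination (1 / 2 : ℝ) * hdef

/-- The Ricci tensor in the directions of the orthogonal basis. -/
theorem trace_curvature {cov : Connection n M} (hcov : IsLeviCivita g cov)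
    {R : ∀ y : M, TangentSpace (𝓡 n) y →ₗ[ℝ] TangentSpace (𝓡 n) y →ₗ[ℝ]
      TangentSpace (𝓡 n) y →ₗ[ℝ] TangentSpace (𝓡 n) y} (hR : IsCurvatureTensor cov R) (a : J) :
    LinearMap.trace ℝ (TangentSpace (𝓡 n) y) (((R y).flip (K (e a) y)).flip (K (e a) y)) =
      ∑ b, ((B ⁅e b, e a⁆ ⁅e b, e a⁆ - ∑ c, B ⁅e b, e a⁆ (e c) ^ 2)
        + (∑ c, B ⁅e b, e a⁆ (e c) ^ 2 *
          ((x a + x b - x c) / 2 - x c / 4 + (x a - x b) ^ 2 / (4 * x c))) / x b) := by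
  obtain ⟨bas, hbas⟩ := hD.exists_basis hK
  rw [trace_eq_of_orthogonal bas (metricForm g y) (x := x)
    (fun i j => by rw [hbas, hbas]; exact hD.inner_basis i j) hD.pos]
  refine Finset.sum_congr rfl fun b _ => ?_
  rw [hbas]
  refine (congrArg (· / x b) (hD.inner_curvature_basis hK hcov hR a b)).trans ?_
  rw [add_div, mul_div_cancel_right₀ _ (hD.pos b).ne']

end IsDiagonalAt
end Ricci

/-! ### The Killing form as a sum over the frame. -/

section KillingTrace
variable {L : Type*} [LieRing L] [LieAlgebra ℝ L] [FiniteDimensional ℝ L]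
  {J : Type*} [Fintype J] [DecidableEq J] {B : LinearMap.BilinForm ℝ L} {e : J → L}

omit [DecidableEq J] in
lemma trace_sum_smulRight_comp (f : L →ₗ[ℝ] L) :
    LinearMap.trace ℝ L ((∑ c, (B (e c)).smulRight (e c)) ∘ₗ f) = ∑ c, B (e c) (f (e c)) := by
  have h : (∑ c, (B (e c)).smulRight (e c)) ∘ₗ f = ∑ c, (B (e c) ∘ₗ f).smulRight (e c) := by
    ext v
    simp
  rw [h, map_sum]
  exact Finset.sum_congr rfl fun c _ => LinearMap.trace_smulRight _ _

/-- The Killing form in terms of brackets of an orthonormal family whose orthogonal complement is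
a subalgebra. -/
theorem killing_eq_sum_lie (symm : ∀ U V, B U V = B V U)
    (lie : ∀ U V W, B ⁅U, V⁆ W = B U ⁅V, W⁆)
    (definite : ∀ U, B U U = 0 → U = 0)
    (killing : ∀ U V, B U V = -killingForm ℝ L U V)
    (orthonormal : ∀ a b, B (e a) (e b) = if a = b then 1 else 0)
    (subalgebra : ∀ U V, (∀ c, B U (e c) = 0) → (∀ c, B V (e c) = 0) → ∀ c, B ⁅U, V⁆ (e c) = 0)
    (a : J) :
    ∑ b, (2 * (B ⁅e b, e a⁆ ⁅e b, e a⁆ - ∑ c, B ⁅e b, e a⁆ (e c) ^ 2)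
      + ∑ c, B ⁅e b, e a⁆ (e c) ^ 2) = 1 := by
  set P : L →ₗ[ℝ] L := ∑ c, (B (e c)).smulRight (e c) with hP
  set f : L →ₗ[ℝ] L := LieAlgebra.ad ℝ L (e a) with hf
  have hPv : ∀ v, P v = ∑ c, B v (e c) • e c := by
    intro v
    simp [hP, LinearMap.sum_apply, symm v]
  have hQ : ∀ v c, B (v - P v) (e c) = 0 := by
    intro v c
    rw [hPv]
    simp [map_sub, map_sum, LinearMap.sub_apply, LinearMap.sum_apply, orthonormal]
  have hQP : ∀ v w, B (v - P v) (P w) = 0 := by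
    intro v w
    rw [hPv w, map_sum]
    exact Finset.sum_eq_zero fun c _ => by rw [map_smul, hQ, smul_zero]
  -- With w the bracket of `e a` and v - Pv, invariance moves the squared norm of w - Pw to the
  -- pairing of `e a` with a bracket of two vectors orthogonal to the frame, which is zero by
  -- `subalgebra`.
  have hmix : ∀ v, f (v - P v) - P (f (v - P v)) = 0 := by
    intro v
    apply definite
    set w := f (v - P v) with hw
    have h1 : B (w - P w) (w - P w) = B w (w - P w) := by
      rw [map_sub B w, LinearMap.sub_apply, symm (P w), hQP, sub_zero]
    rw [h1, hw, hf, LieAlgebra.ad_apply, lie, symm]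
    exact subalgebra _ _ (hQ v) (hQ _) a
  -- Because (1 - P) f (1 - P) = 0, the square f² equals P f² + (1 - P) f P f. By cyclicity both
  -- traces become sums over the frame.
  have hcomp : f ∘ₗ f = P ∘ₗ (f ∘ₗ f) + (f - P ∘ₗ f) ∘ₗ (P ∘ₗ f) := by
    ext v
    have := hmix (f v)
    simp only [LinearMap.add_apply, LinearMap.comp_apply, LinearMap.sub_apply, map_sub] at this ⊢
    rw [← sub_eq_zero, ← this]
    abel
  have htr : LinearMap.trace ℝ L (f ∘ₗ f) = -1 := by
    have := killing (e a) (e a)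
    rw [orthonormal, if_pos rfl, killingForm_apply_apply] at this
    linarith
  have hf' : ∀ b, f (e b) = -⁅e b, e a⁆ := fun b => (lie_skew _ _).symm
  have hBf : ∀ b w, B (e b) (f w) = B ⁅e b, e a⁆ w := fun b w => (lie _ _ _).symm
  rw [hcomp, map_add, hP, trace_sum_smulRight_comp, ← hP, LinearMap.trace_comp_comm',
    LinearMap.comp_assoc, hP, trace_sum_smulRight_comp, ← hP, ← Finset.sum_add_distrib] at htr
  rw [← neg_eq_iff_eq_neg, ← Finset.sum_neg_distrib] at htr
  rw [← htr]
  refine Finset.sum_congr rfl fun b _ => ?_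
  have h1 : B (e b) ((f ∘ₗ f) (e b)) = -B ⁅e b, e a⁆ ⁅e b, e a⁆ := by
    rw [LinearMap.comp_apply, hBf, hf', map_neg]
  have h2 : B (e b) ((f ∘ₗ (f - P ∘ₗ f)) (e b)) =
      -(B ⁅e b, e a⁆ ⁅e b, e a⁆ - ∑ c, B ⁅e b, e a⁆ (e c) ^ 2) := by
    rw [LinearMap.comp_apply, hBf, LinearMap.sub_apply, LinearMap.comp_apply, hf', map_neg P,
      hPv, map_sub, map_neg, map_neg, map_sum]
    simp only [map_smul, smul_eq_mul, sq]
    ring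
  rw [h1, h2]
  ring
end KillingTrace

/-! ### Structure constants of the three modules and the Ricci sums. -/

section StructureConstants
variable {L : Type*} [LieRing L] [LieAlgebra ℝ L] {d : Fin 3 → ℕ} {B : LinearMap.BilinForm ℝ L}
  {e : (Σ i, Fin (d i)) → L}

/-- The sum of the squares of the structure constants with indices in three given modules. -/
def structureSum (B : LinearMap.BilinForm ℝ L) (e : (Σ i, Fin (d i)) → L) (i j k : Fin 3) : ℝ :=
  ∑ α, ∑ β, ∑ γ, B ⁅e ⟨i, α⟩, e ⟨j, β⟩⁆ (e ⟨k, γ⟩) ^ 2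

lemma structureSum_swap (i j k : Fin 3) : structureSum B e i j k = structureSum B e j i k := by
  rw [structureSum, structureSum, Finset.sum_comm]
  refine Finset.sum_congr rfl fun α _ => Finset.sum_congr rfl fun β _ =>
    Finset.sum_congr rfl fun γ _ => ?_
  rw [← lie_skew, map_neg, LinearMap.neg_apply, neg_sq]

lemma structureSum_rotate (symm : ∀ U V, B U V = B V U)
    (lie : ∀ U V W, B ⁅U, V⁆ W = B U ⁅V, W⁆) (i j k : Fin 3) :
    structureSum B e i j k = structureSum B e j k i := by
  rw [structureSum, structureSum, Finset.sum_comm]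
  refine Finset.sum_congr rfl fun α _ => ?_
  rw [Finset.sum_comm]
  refine Finset.sum_congr rfl fun β _ => Finset.sum_congr rfl fun γ _ => ?_
  rw [lie, symm]

lemma structureSum_self (h : ∀ i α β c, B ⁅e ⟨i, α⟩, e ⟨i, β⟩⁆ (e c) = 0) (i k : Fin 3) :
    structureSum B e i i k = 0 := by
  simp [structureSum, h]

lemma sum_structure_eq (ψ : Fin 3 → Fin 3 → ℝ) (i : Fin 3) :
    ∑ α : Fin (d i), ∑ b, ∑ c, B ⁅e b, e ⟨i, α⟩⁆ (e c) ^ 2 * ψ b.1 c.1 =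
      ∑ j, ∑ k, structureSum B e j i k * ψ j k := by
  simp only [Fintype.sum_sigma, structureSum]
  rw [Finset.sum_comm]
  refine Finset.sum_congr rfl fun j _ => ?_
  simp only [Finset.sum_mul]
  symm
  exact (Finset.sum_comm.trans (Finset.sum_congr rfl fun β _ => Finset.sum_comm)).trans
    Finset.sum_comm

/-- The formula for the Ricci curvature of the diagonal metrics, summed over one module. -/
theorem sum_ricci_eq (symm : ∀ U V, B U V = B V U) (lie : ∀ U V W, B ⁅U, V⁆ W = B U ⁅V, W⁆)
    (hself : ∀ i α β c, B ⁅e ⟨i, α⟩, e ⟨i, β⟩⁆ (e c) = 0)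
    (hkilling : ∀ a, ∑ b, (2 * (B ⁅e b, e a⁆ ⁅e b, e a⁆ - ∑ c, B ⁅e b, e a⁆ (e c) ^ 2)
      + ∑ c, B ⁅e b, e a⁆ (e c) ^ 2) = 1)
    (hd : ∀ i, structureSum B e 0 1 2 = d i / 6) (x : Fin 3 → ℝ) (hx : ∀ i, 0 < x i)
    {i j k : Fin 3} (hij : i ≠ j) (hjk : j ≠ k) (hik : i ≠ k) :
    ∑ α : Fin (d i), ∑ b, ((B ⁅e b, e ⟨i, α⟩⁆ ⁅e b, e ⟨i, α⟩⁆ - ∑ c, B ⁅e b, e ⟨i, α⟩⁆ (e c) ^ 2)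
        + (∑ c, B ⁅e b, e ⟨i, α⟩⁆ (e c) ^ 2 *
          ((x i + x b.1 - x c.1) / 2 - x c.1 / 4 + (x i - x b.1) ^ 2 / (4 * x c.1))) / x b.1) =
      d i * (1 / 2 + (x i ^ 2 - x j ^ 2 - x k ^ 2) / (12 * (x j * x k))) := by
  set A := structureSum B e 0 1 2 with hA
  have r := structureSum_rotate (B := B) (e := e) symm lie
  have s := structureSum_swap (B := B) (e := e)
  have z1 := structureSum_self (B := B) hself
  have z2 : ∀ a b, structureSum B e a b a = 0 := fun a b => by rw [← r, z1]
  have z3 : ∀ a b, structureSum B e a b b = 0 := fun a b => by rw [r, z1]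
  have a1 : structureSum B e 1 2 0 = A := (r 0 1 2).symm
  have a2 : structureSum B e 2 0 1 = A := (r 1 2 0).symm.trans a1
  have a3 : structureSum B e 1 0 2 = A := s 1 0 2
  have a4 : structureSum B e 2 1 0 = A := (s 2 1 0).trans a1
  have a5 : structureSum B e 0 2 1 = A := (s 0 2 1).trans a2
  have h1 := sum_structure_eq (B := B) (e := e) (fun _ _ => 1) i
  have h2 := sum_structure_eq (B := B) (e := e)
    (fun b c => ((x i + x b - x c) / 2 - x c / 4 + (x i - x b) ^ 2 / (4 * x c)) / x b) i
  -- The Killing identity trades the 𝔥-parts of the brackets for structure constants.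
  have h3 : ∑ α : Fin (d i), ∑ b, (B ⁅e b, e ⟨i, α⟩⁆ ⁅e b, e ⟨i, α⟩⁆
      - ∑ c, B ⁅e b, e ⟨i, α⟩⁆ (e c) ^ 2) =
      (d i - ∑ α : Fin (d i), ∑ b, ∑ c, B ⁅e b, e ⟨i, α⟩⁆ (e c) ^ 2) / 2 := by
    have := Finset.sum_congr (rfl : (Finset.univ : Finset (Fin (d i))) = _)
      fun α _ => hkilling ⟨i, α⟩
    simp only [Finset.sum_add_distrib, ← Finset.mul_sum, Finset.sum_const, Finset.card_univ,
      Fintype.card_fin, nsmul_eq_mul, mul_one] at this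
    linarith
  simp only [mul_one] at h1
  simp only [Finset.sum_add_distrib, Finset.sum_div] at h3 ⊢
  simp only [mul_div_assoc] at h2 ⊢
  rw [h3, h2, h1]
  have hdi := hd i
  have x0 := (hx 0).ne'
  have x1 := (hx 1).ne'
  have x2 := (hx 2).ne'
  -- Only the sums with three distinct module indices survive, and they all equal A; this relation
  -- makes both sides multiples of A.
  have hd' : (d i : ℝ) = 6 * A := by linarith
  rw [hd']
  fin_cases i <;> fin_cases j <;> fin_cases k <;>
    first
    | exact absurd rfl hij
    | exact absurd rfl hjk
    | exact absurd rfl hik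
    | (simp only [Fin.sum_univ_three, Fin.mk_one, Fin.zero_eta, Fin.reduceFinMk, z1, z2, z3,
        a1, a2, a3, a4, a5, ← hA]
       field_simp
       ring)
end StructureConstants

/-! ### The ordinary differential equations for the parameters. -/

section Evolution

/-- If C bounds |b|, then w² exp(2Ct) is nondecreasing, so w cannot pass from a positive value to
zero. -/
lemma pos_of_hasDerivWithinAt_mul {w b : ℝ → ℝ} {τ : ℝ} (hτ : 0 ≤ τ)
    (hw : ∀ t ∈ Icc 0 τ, HasDerivWithinAt w (w t * b t) (Icc 0 τ) t)
    (hb : ContinuousOn b (Icc 0 τ)) (h0 : 0 < w 0) : 0 < w τ := by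
  by_contra hneg
  have hwc : ContinuousOn w (Icc 0 τ) := fun t ht => (hw t ht).continuousWithinAt
  obtain ⟨t₀, ht₀, hz⟩ := intermediate_value_Icc' hτ hwc ⟨not_lt.1 hneg, h0.le⟩
  obtain ⟨C, hC⟩ := isCompact_Icc.exists_bound_of_continuousOn hb
  have hsub : Icc 0 t₀ ⊆ Icc 0 τ := Icc_subset_Icc_right ht₀.2
  have hder : ∀ t ∈ interior (Icc 0 t₀), HasDerivAt (fun t => w t ^ 2 * Real.exp (2 * C * t))
      (2 * w t ^ 2 * (b t + C) * Real.exp (2 * C * t)) t := by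
    intro t ht
    rw [interior_Icc] at ht
    have htτ : t ∈ Ioo 0 τ := ⟨ht.1, ht.2.trans_le ht₀.2⟩
    have h1 := (hw t (Ioo_subset_Icc_self htτ)).hasDerivAt (Icc_mem_nhds htτ.1 htτ.2)
    have h2 : HasDerivAt (fun t => Real.exp (2 * C * t)) (Real.exp (2 * C * t) * (2 * C)) t := by
      simpa using ((hasDerivAt_id t).const_mul (2 * C)).exp
    refine ((h1.pow 2).mul h2).congr_deriv ?_
    simp only [Pi.pow_apply]
    push_cast
    ring
  have hmono : MonotoneOn (fun t => w t ^ 2 * Real.exp (2 * C * t)) (Icc 0 t₀) := by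
    apply monotoneOn_of_deriv_nonneg (convex_Icc _ _)
    · exact ((hwc.mono hsub).pow 2).mul (by fun_prop)
    · exact fun t ht => (hder t ht).differentiableAt.differentiableWithinAt
    · intro t ht
      rw [(hder t ht).deriv]
      have := neg_le_of_abs_le (hC t (hsub (interior_subset ht)))
      have : 0 ≤ b t + C := by linarith
      positivity
  have := hmono ⟨le_rfl, ht₀.1⟩ ⟨ht₀.1, le_rfl⟩ ht₀.1
  simp only [hz, mul_zero, Real.exp_zero, mul_one] at this
  nlinarith

/-- The Ricci curvature in the direction of a module, in terms of the parameter of that module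
and of the parameters of the two others. -/
def ricciCoeff (a b c : ℝ) : ℝ := 1 / 2 + (a ^ 2 - b ^ 2 - c ^ 2) / (12 * (b * c))

lemma ricciCoeff_comm (a b c : ℝ) : ricciCoeff a b c = ricciCoeff a c b := by
  rw [ricciCoeff, ricciCoeff, mul_comm b c]
  ring

lemma ricciCoeff_pos {a b c : ℝ} (hb : 0 < b) (hc : 0 < c) (h1 : b < c + a)
    (h2 : c < b + a) : 0 < ricciCoeff a b c := by
  have h : ricciCoeff a b c = (4 * (b * c) + (a - (b - c)) * (a + (b - c))) / (12 * (b * c)) := by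
    rw [ricciCoeff]
    field_simp
    ring
  rw [h]
  have := mul_pos (show 0 < a - (b - c) by linarith) (show 0 < a + (b - c) by linarith)
  positivity

/-- The normalized Ricci flow preserves the strict triangle inequality. -/
theorem triangle_of_flow {T : ℝ} {a b c s : ℝ → ℝ}
    (ha : ∀ t ∈ Ico 0 T, 0 < a t) (hb : ∀ t ∈ Ico 0 T, 0 < b t) (hc : ∀ t ∈ Ico 0 T, 0 < c t)
    (da : ∀ t ∈ Ico 0 T, HasDerivWithinAt a
      (-2 * ricciCoeff (a t) (b t) (c t) + 2 * a t * s t) (Ico 0 T) t)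
    (db : ∀ t ∈ Ico 0 T, HasDerivWithinAt b
      (-2 * ricciCoeff (b t) (c t) (a t) + 2 * b t * s t) (Ico 0 T) t)
    (dc : ∀ t ∈ Ico 0 T, HasDerivWithinAt c
      (-2 * ricciCoeff (c t) (a t) (b t) + 2 * c t * s t) (Ico 0 T) t)
    (h0 : c 0 < a 0 + b 0) : ∀ t ∈ Ico 0 T, c t < a t + b t := by
  intro τ hτ
  have hsub : Icc 0 τ ⊆ Ico 0 T := Icc_subset_Ico_right hτ.2
  -- Dividing by c makes the quantity scale invariant, which removes the `s` terms. The numerator of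
  -- r_a + r_b - r_c factors as (a + b - c)(c² + 2(a + b)c + (a - b)²), and differentiating the
  -- denominator contributes 2 r_c / c.
  have hw := pos_of_hasDerivWithinAt_mul (w := fun t => (a t + b t - c t) / c t)
    (b := fun t => -(c t ^ 2 + 2 * (a t + b t) * c t + (a t - b t) ^ 2) / (6 * (a t * b t * c t))
      + 2 * ricciCoeff (c t) (a t) (b t) / c t) hτ.1 ?_ ?_ ?_
  · have h1 := hc τ hτ
    have h2 := (div_pos_iff_of_pos_right h1).1 hw
    linarith
  · intro t ht
    have ht' := hsub ht
    have h := (((da t ht').add (db t ht')).sub (dc t ht')).div (dc t ht') (hc t ht').ne'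
    refine (h.mono hsub).congr_deriv ?_
    have h1 := (ha t ht').ne'
    have h2 := (hb t ht').ne'
    have h3 := (hc t ht').ne'
    simp only [ricciCoeff, Pi.add_apply, Pi.sub_apply]
    field_simp
    ring
  · have ca : ContinuousOn a (Icc 0 τ) := fun t ht => ((da t (hsub ht)).mono hsub).continuousWithinAt
    have cb : ContinuousOn b (Icc 0 τ) := fun t ht => ((db t (hsub ht)).mono hsub).continuousWithinAt
    have cc : ContinuousOn c (Icc 0 τ) := fun t ht => ((dc t (hsub ht)).mono hsub).continuousWithinAt
    have h1 : ∀ t ∈ Icc 0 τ, a t ≠ 0 := fun t ht => (ha t (hsub ht)).ne'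
    have h2 : ∀ t ∈ Icc 0 τ, b t ≠ 0 := fun t ht => (hb t (hsub ht)).ne'
    have h3 : ∀ t ∈ Icc 0 τ, c t ≠ 0 := fun t ht => (hc t (hsub ht)).ne'
    unfold ricciCoeff
    have h4 : ∀ t ∈ Icc 0 τ, 6 * (a t * b t * c t) ≠ 0 := fun t ht => by
      simp [h1 t ht, h2 t ht, h3 t ht]
    have h5 : ∀ t ∈ Icc 0 τ, 12 * (a t * b t) ≠ 0 := fun t ht => by
      simp [h1 t ht, h2 t ht]
    fun_prop (disch := assumption)
  · exact div_pos (by linarith) (hc 0 (hsub ⟨le_rfl, hτ.1⟩))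

end Evolution

/-! ### Killing frames on a generalized Wallach space. -/

section Homogeneous
variable {m n : ℕ} {G : Type*} [TopologicalSpace G] [ChartedSpace (EuclideanSpace ℝ (Fin m)) G]
  [Group G] [LieGroup (𝓡 m) ∞ G]

instance : FiniteDimensional ℝ (GroupLieAlgebra (𝓡 m) G) :=
  inferInstanceAs (FiniteDimensional ℝ (EuclideanSpace ℝ (Fin m)))

variable (m G) in
/-- The form `negKilling`, as a bilinear form. -/
def killingProduct : LinearMap.BilinForm ℝ (GroupLieAlgebra (𝓡 m) G) :=
  -killingForm ℝ (GroupLieAlgebra (𝓡 m) G)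

lemma killingProduct_apply (X Y : GroupLieAlgebra (𝓡 m) G) :
    killingProduct m G X Y = negKilling X Y := rfl

lemma killingProduct_symm (X Y : GroupLieAlgebra (𝓡 m) G) :
    killingProduct m G X Y = killingProduct m G Y X :=
  congrArg Neg.neg (LieModule.traceForm_comm ℝ _ _ X Y)

lemma killingProduct_lie (X Y Z : GroupLieAlgebra (𝓡 m) G) :
    killingProduct m G ⁅X, Y⁆ Z = killingProduct m G X ⁅Y, Z⁆ :=
  congrArg Neg.neg (LieModule.traceForm_apply_lie_apply ℝ _ _ X Y Z)

variable {H : Subgroup G} [ChartedSpace (EuclideanSpace ℝ (Fin n)) (G ⧸ H)]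

/-- The action of `G` on `G ⧸ H`, twisted by the conjugation by `a`. -/
def twistedSMul (H : Subgroup G) (a b : G) (y : G ⧸ H) : G ⧸ H := (a * b * a⁻¹) • y

lemma IsHomogeneousManifold.isSmoothAction (h : IsHomogeneousManifold m n H) (a : G) :
    IsSmoothAction m n (twistedSMul H a) where
  contMDiff := by
    have := h.smooth_smul
    have h1 : ContMDiff ((𝓡 m).prod (𝓡 n)) ((𝓡 m).prod (𝓡 n)) ∞
        (fun q : G × (G ⧸ H) => (a * q.1 * a⁻¹, q.2)) :=
      ((contMDiff_const.mul contMDiff_fst).mul contMDiff_const).prodMk contMDiff_snd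
    exact (this.contMDiff_smul).comp h1
  mul b c y := by
    rw [twistedSMul, twistedSMul, twistedSMul, smul_smul]
    congr 1
    group
  one y := by simp [twistedSMul]

omit [LieGroup (𝓡 m) ∞ G] in
lemma IsHomogeneousManifold.mdifferentiable_smul (h : IsHomogeneousManifold m n H) (a : G) :
    MDifferentiable (𝓡 n) (𝓡 n) (fun y : G ⧸ H => a • y) := by
  have := h.smooth_smul
  exact ((this.contMDiff_smul).comp (contMDiff_const.prodMk contMDiff_id) :
    ContMDiff (𝓡 n) (𝓡 n) ∞ (fun y : G ⧸ H => a • y)).mdifferentiable (by simp)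

-- Since (a b a⁻¹) · (a · o) = a · (b · o), the twisted fields at a · o are the translates by `a` of
-- the vectors at the base point o. The same Lie algebra frame thus diagonalizes the metric at every
-- point.
omit [LieGroup (𝓡 m) ∞ G] in
lemma IsHomogeneousManifold.fundField_eq (h : IsHomogeneousManifold m n H) (a : G)
    (X : GroupLieAlgebra (𝓡 m) G) :
    fundField (n := n) (twistedSMul H a) X (a • ((1 : G) : G ⧸ H)) =
      mderiv (𝓡 n) (𝓡 n) (fun y : G ⧸ H => a • y) ((1 : G) : G ⧸ H) (dproj n H X) := by
  have h1 := mderiv_comp (I := 𝓡 m) (I' := 𝓡 n) (I'' := 𝓡 n) (g := fun y : G ⧸ H => a • y)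
    (f := fun b : G => (b : G ⧸ H)) 1 (h.mdifferentiable_smul a _)
    (h.smooth_mk.mdifferentiable (by simp) _) X
  have h2 : (fun b => twistedSMul H a b (a • ((1 : G) : G ⧸ H))) =
      fun b : G => a • (b : G ⧸ H) := by
    funext b
    rw [twistedSMul, smul_smul]
    change ((a * b * a⁻¹ * a * 1 : G) : G ⧸ H) = ((a * b : G) : G ⧸ H)
    congr 1
    group
  rw [fundField, h2]
  exact h1

omit [LieGroup (𝓡 m) ∞ G] in
lemma IsHomogeneousManifold.surjective_mderiv_smul (h : IsHomogeneousManifold m n H) (a : G)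
    (v : EuclideanSpace ℝ (Fin n)) :
    ∃ w, mderiv (𝓡 n) (𝓡 n) (fun y : G ⧸ H => a • y) ((1 : G) : G ⧸ H) w = v := by
  have h1 := mderiv_comp (I := 𝓡 n) (I' := 𝓡 n) (I'' := 𝓡 n) (g := fun y : G ⧸ H => a • y)
    (f := fun y : G ⧸ H => a⁻¹ • y) (a • ((1 : G) : G ⧸ H)) (h.mdifferentiable_smul a _)
    (h.mdifferentiable_smul a⁻¹ _) v
  simp only [smul_inv_smul, inv_smul_smul] at h1
  rw [mderiv_id] at h1
  exact ⟨_, h1.symm⟩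

lemma IsInvariantMetric.isKillingFamily [IsManifold (𝓡 n) ∞ (G ⧸ H)]
    (h : IsHomogeneousManifold m n H)
    {p : Fin 3 → Submodule ℝ (GroupLieAlgebra (𝓡 m) G)} {x : Fin 3 → ℝ} {g : Metric n (G ⧸ H)}
    (hg : IsInvariantMetric p x g) (a : G) :
    IsKillingFamily g (fundField (m := m) (twistedSMul H a)) :=
  (h.isSmoothAction a).isKillingFamily g fun b y v w => hg.invariant (a * b * a⁻¹) y v w

variable {p : Fin 3 → Submodule ℝ (GroupLieAlgebra (𝓡 m) G)} {d : Fin 3 → ℕ}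

/-- The vectors of orthonormal bases of the three modules. -/
def moduleFrame (e : ∀ i, Module.Basis (Fin (d i)) ℝ (p i)) (c : Σ i, Fin (d i)) :
    GroupLieAlgebra (𝓡 m) G := e c.1 c.2

variable (hW : IsGeneralizedWallach n H p) {e : ∀ i, Module.Basis (Fin (d i)) ℝ (p i)}
  (he : AreOrthonormal e)
include hW

lemma IsGeneralizedWallach.definite (X : GroupLieAlgebra (𝓡 m) G)
    (h : killingProduct m G X X = 0) : X = 0 := by
  by_contra hX
  exact (hW.pos X hX).ne' h

lemma IsGeneralizedWallach.lie_moduleFrame_self (i : Fin 3) (α β : Fin (d i))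
    (c : Σ i, Fin (d i)) :
    killingProduct m G ⁅moduleFrame e ⟨i, α⟩, moduleFrame e ⟨i, β⟩⁆ (moduleFrame e c) = 0 := by
  rw [killingProduct_symm]
  exact (hW.sum_eq _).1 (Submodule.mem_iSup_of_mem c.1 (e c.1 c.2).2) _
    (hW.bracket_mem i _ (e i α).2 _ (e i β).2)

/-- The frame spans 𝔥^⊥, and 𝔥^⊥⊥ = 𝔥 because the form is definite. -/
lemma IsGeneralizedWallach.mem_isotropyAlgebra {Z : GroupLieAlgebra (𝓡 m) G}
    (hZ : ∀ c, killingProduct m G Z (moduleFrame e c) = 0) : Z ∈ isotropyAlgebra n H := by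
  have hrefl : (killingProduct m G).IsRefl := fun X Y h => by rw [killingProduct_symm, h]
  have hnd : (killingProduct m G).Nondegenerate :=
    ⟨fun X h => hW.definite X (h X), fun X h => hW.definite X (h X)⟩
  rw [← LinearMap.BilinForm.orthogonal_orthogonal hnd hrefl (isotropyAlgebra n H)]
  intro X hX
  have hX' : X ∈ ⨆ i, p i := by
    rw [hW.sum_eq]
    intro Y hY
    rw [← killingProduct_apply, killingProduct_symm]
    exact hX Y hY
  change killingProduct m G X Z = 0
  rw [killingProduct_symm]
  have hle : ⨆ i, p i ≤ LinearMap.ker (killingProduct m G Z) := by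
    refine iSup_le fun i X hX => ?_
    have := congrArg (Subtype.val) ((e i).sum_repr ⟨X, hX⟩)
    rw [LinearMap.mem_ker]
    simp only [Submodule.coe_sum, Submodule.coe_smul] at this
    rw [← this, map_sum]
    exact Finset.sum_eq_zero fun α _ => by
      rw [map_smul, show killingProduct m G Z (e i α) = 0 from hZ ⟨i, α⟩, smul_zero]
  exact hle hX'

include he

lemma IsGeneralizedWallach.orthonormal_moduleFrame (a b : Σ i, Fin (d i)) :
    killingProduct m G (moduleFrame e a) (moduleFrame e b) = if a = b then 1 else 0 := by
  obtain ⟨i, α⟩ := a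
  obtain ⟨j, β⟩ := b
  by_cases hij : i = j
  · subst hij
    refine (he i α β).trans ?_
    simp
  · rw [if_neg fun h => hij (congrArg Sigma.fst h)]
    exact hW.orthogonal i j hij _ (e i α).2 _ (e j β).2

theorem IsGeneralizedWallach.isDiagonalAt [IsManifold (𝓡 n) ∞ (G ⧸ H)] {x : Fin 3 → ℝ}
    {g : Metric n (G ⧸ H)} (hg : IsInvariantMetric p x g) (a : G) :
    IsDiagonalAt g (fundField (m := m) (twistedSMul H a)) (a • ((1 : G) : G ⧸ H))
      (killingProduct m G) (moduleFrame e) (fun c => x c.1) where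
  symm := killingProduct_symm
  lie := killingProduct_lie
  orthonormal := hW.orthonormal_moduleFrame he
  pos c := hg.pos c.1
  surjective v := by
    obtain ⟨w, hw⟩ := hW.homogeneous.surjective_mderiv_smul a v
    obtain ⟨X, hX⟩ := hW.homogeneous.submersion 1 w
    refine ⟨X, (hW.homogeneous.fundField_eq a X).trans ?_⟩
    rw [← hw]
    exact congrArg (mderiv (𝓡 n) (𝓡 n) (fun y : G ⧸ H => a • y) ((1 : G) : G ⧸ H)) hX
  inner U V := by
    let D : GroupLieAlgebra (𝓡 m) G →ₗ[ℝ] TangentSpace (𝓡 n) ((1 : G) : G ⧸ H) :=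
      (dproj n H).toLinearMap
    let q := (IsDiagonalAt.metricForm g ((1 : G) : G ⧸ H)).compl₁₂ D D
    have h1 : g.inner (a • ((1 : G) : G ⧸ H))
        (fundField (m := m) (twistedSMul H a) U (a • ((1 : G) : G ⧸ H)))
        (fundField (m := m) (twistedSMul H a) V (a • ((1 : G) : G ⧸ H))) = q U V := by
      rw [hW.homogeneous.fundField_eq, hW.homogeneous.fundField_eq]
      exact hg.invariant a _ _ _
    rw [h1]
    have hD : ∀ U, D U = D (∑ c, killingProduct m G U (moduleFrame e c) • moduleFrame e c) := by
      intro U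
      rw [← sub_eq_zero, ← map_sub]
      refine LinearMap.mem_ker.1 (hW.mem_isotropyAlgebra (e := e) fun c => ?_)
      simp [map_sub, map_sum, LinearMap.sub_apply, LinearMap.sum_apply,
        hW.orthonormal_moduleFrame he]
    have hq : ∀ b c, q (moduleFrame e b) (moduleFrame e c) = if b = c then x b.1 else 0 := by
      intro b c
      have h2 := hg.diagonal b.1 c.1 _ (e b.1 b.2).2 _ (e c.1 c.2).2
      have h3 := hW.orthonormal_moduleFrame he b c
      refine h2.trans ?_
      rw [← killingProduct_apply]
      erw [h3]
      by_cases hbc : b = c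
      · simp [hbc]
      · simp [hbc]
    have h4 : q U V = q (∑ c, killingProduct m G U (moduleFrame e c) • moduleFrame e c)
        (∑ c, killingProduct m G V (moduleFrame e c) • moduleFrame e c) := by
      simp only [q, LinearMap.compl₁₂_apply]
      rw [← hD U, ← hD V]
    rw [h4]
    simp only [map_sum, map_smul, LinearMap.sum_apply, LinearMap.smul_apply, hq, smul_eq_mul,
      mul_ite, mul_zero, Finset.sum_ite_eq', Finset.mem_univ, if_true]
    refine Finset.sum_congr rfl fun c _ => by ring

end Homogeneous

/-- Elements orthogonal to the frame generate fields vanishing at `y`. For two of them, the Killing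
equation forces the bracket to be orthogonal to the frame as well. -/
lemma IsDiagonalAt.lie_subalgebra {n : ℕ} {M : Type*} [TopologicalSpace M]
    [ChartedSpace (EuclideanSpace ℝ (Fin n)) M] [IsManifold (𝓡 n) ∞ M]
    {L : Type*} [LieRing L] [LieAlgebra ℝ L] {J : Type*} [Fintype J] [DecidableEq J]
    {g : Metric n M} {K : L → ∀ y : M, TangentSpace (𝓡 n) y} {y : M}
    {B : LinearMap.BilinForm ℝ L} {e : J → L} {x : J → ℝ}
    (hD : IsDiagonalAt g K y B e x) (hK : IsKillingFamily g K) {U V : L}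
    (hU : ∀ c, B U (e c) = 0) (hV : ∀ c, B V (e c) = 0) (c : J) : B ⁅U, V⁆ (e c) = 0 := by
  have h0 : ∀ W, (∀ c, B W (e c) = 0) → K W y = 0 := by
    intro W hW
    rw [hD.map_eq_sum hK W]
    exact Finset.sum_eq_zero fun c _ => by rw [hW, zero_smul]
  have h1 := hK.killing U V (e c) y
  rw [h0 U hU, map_zero] at h1
  have h2 : (0 : ℝ) = -g.inner y (K ⁅U, V⁆ y) (K (e c) y)
    - g.inner y (K V y) (K ⁅U, e c⁆ y) := h1
  rw [g.symm y (K V y), h0 V hV, map_zero, hD.inner_right] at h2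
  have h3 : x c * B ⁅U, V⁆ (e c) = 0 := by linarith
  exact (mul_eq_zero.1 h3).resolve_left (hD.pos c).ne'

/-! ### Ricci curvature along the flow. -/

section Flow
variable {m n : ℕ} {G : Type*} [TopologicalSpace G] [ChartedSpace (EuclideanSpace ℝ (Fin m)) G]
  [Group G] [LieGroup (𝓡 m) ∞ G] {H : Subgroup G} [ChartedSpace (EuclideanSpace ℝ (Fin n)) (G ⧸ H)]
  [IsManifold (𝓡 n) ∞ (G ⧸ H)]
  {p : Fin 3 → Submodule ℝ (GroupLieAlgebra (𝓡 m) G)} {d : Fin 3 → ℕ}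
  (hW : IsGeneralizedWallach n H p) {e : ∀ i, Module.Basis (Fin (d i)) ℝ (p i)}
  (he : AreOrthonormal e) (ha : ∀ i, wallachConstant e i = 1 / 6)

/-- The Ricci curvature, in the direction of the `i`-th module, of the metric with parameters `x`
on a generalized Wallach space with constants `1 / 6`. -/
def moduleRicci (x : Fin 3 → ℝ) (i : Fin 3) : ℝ := ricciCoeff (x i) (x (i + 1)) (x (i + 2))

omit [ChartedSpace (EuclideanSpace ℝ (Fin n)) (G ⧸ H)] [IsManifold (𝓡 n) ∞ (G ⧸ H)] in
include ha in
lemma structureSum_eq_of_wallachConstant (i : Fin 3) :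
    0 < d i ∧ structureSum (killingProduct m G) (moduleFrame e) 0 1 2 = d i / 6 := by
  have h : structureSum (killingProduct m G) (moduleFrame e) 0 1 2 / d i = 1 / 6 := ha i
  have hd : d i ≠ 0 := fun h0 => by simp [h0] at h
  refine ⟨Nat.pos_of_ne_zero hd, ?_⟩
  have : (d i : ℝ) ≠ 0 := Nat.cast_ne_zero.2 hd
  field_simp at h
  linarith

include hW he ha

/-- Only the sum over a module is accessible here, because the Wallach constants control sums of
squared structure constants and not the separate terms. -/
theorem sum_ricci_moduleFrame {x : Fin 3 → ℝ} {g : Metric n (G ⧸ H)} (hg : IsInvariantMetric p x g)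
    {Ric : ∀ y : G ⧸ H, TangentSpace (𝓡 n) y → TangentSpace (𝓡 n) y → ℝ}
    (hRic : IsRicciTensor g Ric) (a : G) (i : Fin 3) :
    ∑ α : Fin (d i), Ric (a • ((1 : G) : G ⧸ H))
        (fundField (m := m) (twistedSMul H a) (moduleFrame e ⟨i, α⟩) _)
        (fundField (m := m) (twistedSMul H a) (moduleFrame e ⟨i, α⟩) _) =
      d i * moduleRicci x i := by
  have hD := hW.isDiagonalAt he hg a
  have hK := hg.isKillingFamily hW.homogeneous a
  obtain ⟨cov, hcov, R, hR, hRic⟩ := hRic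
  have h := sum_ricci_eq (B := killingProduct m G) (e := moduleFrame e) killingProduct_symm
    killingProduct_lie hW.lie_moduleFrame_self
    (killing_eq_sum_lie killingProduct_symm killingProduct_lie hW.definite (fun _ _ => rfl)
      (hW.orthonormal_moduleFrame he) (fun _ _ hU hV => hD.lie_subalgebra hK hU hV))
    (fun i => (structureSum_eq_of_wallachConstant ha i).2) x hg.pos
    (i := i) (j := i + 1) (k := i + 2) (by revert i; decide) (by revert i; decide)
    (by revert i; decide)
  refine Eq.trans (Finset.sum_congr rfl fun α _ => ?_) h
  rw [hRic]
  exact hD.trace_curvature hK hcov hR ⟨i, α⟩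

variable {T : ℝ} {x : ℝ → Fin 3 → ℝ} {g : ℝ → Metric n (G ⧸ H)}
  (hg : ∀ t ∈ Ico (0 : ℝ) T, IsInvariantMetric p (x t) (g t))
include hg

/-- The flow equation determines Ric from the metric, its derivative and S. In the frame the metric
stays diagonal with entry x_i on all of p_i, so Ric is diagonal and constant on each module; its sum
over the module fixes the constant. -/
theorem ricci_moduleFrame_of_flow {t : ℝ} (ht : t ∈ Ico 0 T)
    {Ric : ∀ y : G ⧸ H, TangentSpace (𝓡 n) y → TangentSpace (𝓡 n) y → ℝ} {S : G ⧸ H → ℝ}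
    (hRic : IsRicciTensor (g t) Ric)
    (hder : ∀ (y : G ⧸ H) (v w : TangentSpace (𝓡 n) y),
      HasDerivWithinAt (fun s => (g s).inner y v w)
        (-2 * Ric y v w + 2 * (g t).inner y v w * (S y / n)) (Ico 0 T) t) (a : G) :
    (∀ b c, Ric (a • ((1 : G) : G ⧸ H))
        (fundField (m := m) (twistedSMul H a) (moduleFrame e b) _)
        (fundField (m := m) (twistedSMul H a) (moduleFrame e c) _) =
      if b = c then moduleRicci (x t) b.1 else 0) ∧
    ∀ i, HasDerivWithinAt (fun s => x s i)
      (-2 * moduleRicci (x t) i + 2 * x t i * (S (a • ((1 : G) : G ⧸ H)) / n)) (Ico 0 T) t := by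
  set y := a • ((1 : G) : G ⧸ H) with hy
  set K := fundField (n := n) (m := m) (twistedSMul H a) with hKdef
  have hD := fun s hs => hW.isDiagonalAt he (hg s hs) a
  have huniq : UniqueDiffWithinAt ℝ (Ico 0 T) t := uniqueDiffOn_Ico 0 T t ht
  have hbc : ∀ b c, HasDerivWithinAt (fun s => if b = c then x s b.1 else 0)
      (-2 * Ric y (K (moduleFrame e b) y) (K (moduleFrame e c) y)
        + 2 * (if b = c then x t b.1 else 0) * (S y / n)) (Ico 0 T) t := by
    intro b c
    have h := hder y (K (moduleFrame e b) y) (K (moduleFrame e c) y)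
    rw [(hD t ht).inner_basis b c] at h
    exact h.congr (fun s hs => ((hD s hs).inner_basis b c).symm) ((hD t ht).inner_basis b c).symm
  have hself : ∀ b, HasDerivWithinAt (fun s => x s b.1)
      (-2 * Ric y (K (moduleFrame e b) y) (K (moduleFrame e b) y)
        + 2 * x t b.1 * (S y / n)) (Ico 0 T) t := fun b => by
    simpa only [if_true] using hbc b b
  have hdiag : ∀ b, Ric y (K (moduleFrame e b) y) (K (moduleFrame e b) y) =
      moduleRicci (x t) b.1 := by
    rintro ⟨i, α⟩
    have hconst : ∀ β, Ric y (K (moduleFrame e ⟨i, β⟩) y) (K (moduleFrame e ⟨i, β⟩) y) =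
        Ric y (K (moduleFrame e ⟨i, α⟩) y) (K (moduleFrame e ⟨i, α⟩) y) := by
      intro β
      have := huniq.eq_deriv _ (hself ⟨i, β⟩) (hself ⟨i, α⟩)
      linarith
    have hsum := sum_ricci_moduleFrame hW he ha (hg t ht) hRic a i
    rw [Finset.sum_congr rfl fun β _ => hconst β, Finset.sum_const, Finset.card_univ,
      Fintype.card_fin, nsmul_eq_mul] at hsum
    exact mul_left_cancel₀
      (Nat.cast_ne_zero.2 (structureSum_eq_of_wallachConstant ha i).1.ne') hsum
  refine ⟨fun b c => ?_, fun i => ?_⟩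
  · split_ifs with h
    · rw [← h, hdiag]
    · have h1 := hbc b c
      simp only [if_neg h] at h1
      -- An off-diagonal entry of the metric is identically zero, so its derivative -2 Ric is zero.
      have := huniq.eq_deriv _ h1 (hasDerivWithinAt_const t _ 0)
      linarith
  · have h := hself ⟨i, ⟨0, (structureSum_eq_of_wallachConstant ha i).1⟩⟩
    rw [hdiag] at h
    exact h

theorem moduleRicci_pos_of_flow (hflow : IsNormalizedRicciFlow T g)
    (h0 : ∀ i j k : Fin 3, i ≠ j → j ≠ k → i ≠ k → x 0 k < x 0 i + x 0 j) {t : ℝ}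
    (ht : t ∈ Ico 0 T) (i : Fin 3) : 0 < moduleRicci (x t) i := by
  choose! Ric S hRic hS hder using hflow
  have hx : ∀ i, ∀ t ∈ Ico 0 T, 0 < x t i := fun i t ht => (hg t ht).pos i
  -- The parameters do not depend on the point, so the equations at the base point suffice, with the
  -- same value of S in all three.
  have h := fun i t ht =>
    (ricci_moduleFrame_of_flow hW he ha hg ht (hRic t ht) (hder t ht) 1).2 i
  have h' : ∀ i j k : Fin 3, i ≠ j → j ≠ k → i ≠ k → ∀ t ∈ Ico 0 T, HasDerivWithinAt
      (fun s => x s i) (-2 * ricciCoeff (x t i) (x t j) (x t k)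
        + 2 * x t i * (S t ((1 : G) • ((1 : G) : G ⧸ H)) / n)) (Ico 0 T) t := by
    intro i j k hij hjk hik t ht
    have : (j = i + 1 ∧ k = i + 2) ∨ (j = i + 2 ∧ k = i + 1) := by
      revert i j k; decide
    obtain ⟨rfl, rfl⟩ | ⟨rfl, rfl⟩ := this
    · exact h i t ht
    · rw [ricciCoeff_comm]
      exact h i t ht
  have htri : ∀ i j k : Fin 3, i ≠ j → j ≠ k → i ≠ k → x t k < x t i + x t j :=
    fun i j k hij hjk hik =>
      triangle_of_flow (hx i) (hx j) (hx k) (h' i j k hij hjk hik) (h' j k i hjk hik.symm hij.symm)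
        (h' k i j hik.symm hij hjk.symm) (h0 i j k hij hjk hik) t ht
  have h01 : i ≠ i + 1 := by revert i; decide
  have h12 : i + 1 ≠ i + 2 := by revert i; decide
  have h02 : i ≠ i + 2 := by revert i; decide
  exact ricciCoeff_pos (hx _ t ht) (hx _ t ht) (htri _ _ _ h02.symm h01 h12.symm)
    (htri _ _ _ h01.symm h02 h12)

theorem hasPositiveRicci_of_flow (hflow : IsNormalizedRicciFlow T g)
    (h0 : ∀ i j k : Fin 3, i ≠ j → j ≠ k → i ≠ k → x 0 k < x 0 i + x 0 j) :
    ∀ t ∈ Ico (0 : ℝ) T, HasPositiveRicci (g t) := by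
  intro t ht
  have hpos := fun i => moduleRicci_pos_of_flow hW he ha hg hflow h0 ht i
  obtain ⟨Ric, S, hRic, hS, hder⟩ := hflow t ht
  refine ⟨Ric, hRic, fun y v hv => ?_⟩
  obtain ⟨a, rfl⟩ := QuotientGroup.mk_surjective y
  have hy : ((a : G) : G ⧸ H) = a • ((1 : G) : G ⧸ H) := by
    change _ = ((a * 1 : G) : G ⧸ H)
    rw [mul_one]
  revert v
  rw [hy]
  intro v hv
  obtain ⟨bas, hbas⟩ := (hW.isDiagonalAt he (hg t ht) a).exists_basis
    ((hg t ht).isKillingFamily hW.homogeneous a)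
  have hframe := (ricci_moduleFrame_of_flow hW he ha hg ht hRic hder a).1
  obtain ⟨cov, hcov, R, hR, hRic⟩ := hRic
  -- As a trace of the curvature, `Ric` is bilinear, so positivity follows from its diagonal form in
  -- the frame.
  let q : TangentSpace (𝓡 n) (a • ((1 : G) : G ⧸ H)) →ₗ[ℝ]
      TangentSpace (𝓡 n) (a • ((1 : G) : G ⧸ H)) →ₗ[ℝ] ℝ :=
    LinearMap.mk₂ ℝ (Ric (a • ((1 : G) : G ⧸ H)))
      (fun u v w => by 
        rw [hRic, hRic, hRic, ← map_add (LinearMap.trace ℝ _)]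
        exact congrArg _ (LinearMap.ext fun z => LinearMap.congr_fun (map_add (R _ z) u v) w))
      (fun c u w => by 
        rw [hRic, hRic, ← map_smul (LinearMap.trace ℝ _)]
        exact congrArg _ (LinearMap.ext fun z => LinearMap.congr_fun (map_smul (R _ z) c u) w))
      (fun u v w => by simp only [hRic, map_add])
      (fun c u w => by simp only [hRic, map_smul])
  have hq : ∀ b c, q (bas b) (bas c) = if b = c then moduleRicci (x t) b.1 else 0 := by
    intro b c
    rw [hbas, hbas]
    exact hframe b c
  have hqv : q v v = ∑ b, bas.repr v b ^ 2 * moduleRicci (x t) b.1 := by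
    refine (congrArg (q v) (bas.sum_repr v)).symm.trans ?_
    rw [map_sum]
    refine Finset.sum_congr rfl fun b _ => ?_
    rw [map_smul, repr_eq_of_orthogonal bas q hq, smul_eq_mul]
    ring
  change 0 < q v v
  rw [hqv]
  obtain ⟨b, hb⟩ : ∃ b, bas.repr v b ≠ 0 := by
    by_contra! h
    exact hv (bas.repr.map_eq_zero_iff.1 (Finsupp.ext h))
  exact Finset.sum_pos' (fun b _ => mul_nonneg (sq_nonneg _) (hpos b.1).le)
    ⟨b, Finset.mem_univ _, mul_pos (by positivity) (hpos b.1)⟩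

end Flow

end Wallach

end

theorem theorem4 {m n : ℕ} {G : Type*} [TopologicalSpace G] [T2Space G] [CompactSpace G]
    [ChartedSpace (EuclideanSpace ℝ (Fin m)) G] [Group G] [LieGroup (𝓡 m) ∞ G]
    (H : Subgroup G)
    [ChartedSpace (EuclideanSpace ℝ (Fin n)) (G ⧸ H)] [IsManifold (𝓡 n) ∞ (G ⧸ H)]
    (p : Fin 3 → Submodule ℝ (GroupLieAlgebra (𝓡 m) G))
    (hW : Wallach.IsGeneralizedWallach n H p)
    {d : Fin 3 → ℕ} (e : ∀ i, Module.Basis (Fin (d i)) ℝ (p i))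
    (he : Wallach.AreOrthonormal e)
    (ha : ∀ i, Wallach.wallachConstant e i = 1 / 6)
    (T : ℝ) (x : ℝ → Fin 3 → ℝ) (g : ℝ → Wallach.Metric n (G ⧸ H))
    (hg : ∀ t ∈ Ico (0 : ℝ) T, Wallach.IsInvariantMetric p (x t) (g t))
    (hflow : Wallach.IsNormalizedRicciFlow T g)
    (h0 : ∀ i j k : Fin 3, i ≠ j → j ≠ k → i ≠ k → x 0 k < x 0 i + x 0 j) :
    ∀ t ∈ Ico (0 : ℝ) T, Wallach.HasPositiveRicci (g t) :=
  Wallach.hasPositiveRicci_of_flow hW he ha hg hflow h0
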